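/- Let $M\ge N\ge 2$, let $H\in\mathbb C^{N\times M}$ be a random channel matrix with i.i.d. $\mathcal{CN}(0,1)$ entries, and let $\lambda_{\min}$ be the smallest eigenvalue of $HH^H$. Fix a spectral efficiency $R>0$ and a regularization constant $c>0$. Let the precoder be either the regularized zero-forcing (RZF) precoder $P=\beta H^H(HH^H+cI)^{-1}$ or the matched-filter (MF) precoder $P=\beta H^H$, where $\beta>0$ is normalized so that $\operatorname{tr}(PP^H)=1$. Put $G=HP$, and let $W=(G^HG)^{-1}G^H$ be the zero-forcing equalizer of the composite channel $G$. In the system $y=WGx+Wn$, where $x$ has covariance $\frac{\rho}{N}I$ and the noise $n$, uncorrelated with $x$, has covariance $I$, the SINR of stream $k$ is $$\gamma_k=\frac{\frac{\rho}{N}\,|(WG)_{kk}|^2}{\frac{\rho}{N}\sum_{i\ne k}|(WG)_{ki}|^2+(WW^H)_{kk}},$$ and the outage probability under joint spatial encoding is $$P_{\mathrm{out}}(\rho)=\mathbb P\Big(\sum_{k=1}^N\log_2(1+\gamma_k)\le R\Big).$$ Write $f\doteq g$ if $f,g$ are positive for all large $\rho$ and the limits $\lim_{\rho\to\infty}\frac{\log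 f(\rho)}{\log\rho}$ and $\lim_{\rho\to\infty}\frac{\log g(\rho)}{\log\rho}$ exist, are finite and are equal. Then, for the RZF precoder as well as for the MF precoder, $$P_{\mathrm{out}}(\rho)\doteq\mathbb P\big(\lambda_{\min}\le\rho^{-1/2}\big),$$ and the outage diversity is the possibly fractional value $$d=-\lim_{\rho\to\infty}\frac{\log P_{\mathrm{out}}(\rho)}{\log\rho}=\tfrac12(M-N+1).$$ -/

import Mathlib

open MeasureTheory ProbabilityTheory Filter Topology
open scoped Matrix

noncomputable section

namespace PrecodedMIMO

/-- The standard circularly-symmetric complex Gaussian law `CN(0,1)`: independent real and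
imaginary parts, each `N(0,1/2)`. -/
def stdComplexGaussian : Measure ℂ :=
  ((gaussianReal 0 (1 / 2)).prod (gaussianReal 0 (1 / 2))).map
    (fun p : ℝ × ℝ => (p.1 : ℂ) + (p.2 : ℂ) * Complex.I)

/-- A flat Rayleigh fading channel with `M` transmit and `N` receive antennas: the entries of the
`N × M` channel matrix are i.i.d. `CN(0,1)`. -/
structure IsRayleighChannel {Ω : Type*} [MeasurableSpace Ω] (P : Measure Ω) {N M : ℕ}
    (H : Ω → Matrix (Fin N) (Fin M) ℂ) : Prop where
  hasLaw : ∀ i j, HasLaw (fun ω => H ω i j) stdComplexGaussian P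
  indep : iIndepFun (fun (p : Fin N × Fin M) (ω : Ω) => H ω p.1 p.2) P

/-- The precoder `β T` with `β = 1 / √η`, `η = tr (T Tᴴ)`. -/
def normalizedPrecoder {M N : ℕ} (T : Matrix (Fin M) (Fin N) ℂ) : Matrix (Fin M) (Fin N) ℂ :=
  (((Real.sqrt (T * Tᴴ).trace.re)⁻¹ : ℝ) : ℂ) • T

/-- The regularized zero-forcing precoder `β Hᴴ (H Hᴴ + c I)⁻¹`. -/
def rzfPrecoder {N M : ℕ} (c : ℝ) (H : Matrix (Fin N) (Fin M) ℂ) : Matrix (Fin M) (Fin N) ℂ :=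
  normalizedPrecoder (Hᴴ * (H * Hᴴ + (c : ℂ) • (1 : Matrix (Fin N) (Fin N) ℂ))⁻¹)

/-- The matched-filter precoder `β Hᴴ`. -/
def mfPrecoder {N M : ℕ} (H : Matrix (Fin N) (Fin M) ℂ) : Matrix (Fin M) (Fin N) ℂ :=
  normalizedPrecoder Hᴴ

/-- The zero-forcing equalizer `(Gᴴ G)⁻¹ Gᴴ` of a composite channel `G`. -/
def zfEqualizer {N : ℕ} (G : Matrix (Fin N) (Fin N) ℂ) : Matrix (Fin N) (Fin N) ℂ :=
  (Gᴴ * G)⁻¹ * Gᴴ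

/-- The SINR of stream `k` in `y = W G x + W n`, where `x` has covariance `(ρ / N) I` and the noise
`n`, uncorrelated with `x`, has covariance `I`: the power of the desired signal over the sum of the
powers of the interference and of the filtered noise. -/
def sinr {N : ℕ} (ρ : ℝ) (G W : Matrix (Fin N) (Fin N) ℂ) (k : Fin N) : ℝ :=
  (ρ / N * ‖(W * G) k k‖ ^ 2) /
    (ρ / N * ∑ i ∈ Finset.univ.erase k, ‖(W * G) k i‖ ^ 2 + ((W * Wᴴ) k k).re)

/-- The outage probability, at SNR `ρ` and spectral efficiency `R` (in bits), of joint spatial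
encoding when the precoder `prec` is used and the composite channel is zero-forcing equalized. -/
def outageZF {Ω : Type*} [MeasurableSpace Ω] (P : Measure Ω) {N M : ℕ}
    (H : Ω → Matrix (Fin N) (Fin M) ℂ)
    (prec : Matrix (Fin N) (Fin M) ℂ → Matrix (Fin M) (Fin N) ℂ) (R ρ : ℝ) : ℝ :=
  P.real {ω | ∑ k, Real.logb 2
    (1 + sinr ρ (H ω * prec (H ω)) (zfEqualizer (H ω * prec (H ω))) k) ≤ R}

/-- The smallest eigenvalue of `H Hᴴ`. -/
def lambdaMin {N M : ℕ} (H : Matrix (Fin N) (Fin M) ℂ) : ℝ :=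
  ⨅ k, (Matrix.isHermitian_mul_conjTranspose_self H).eigenvalues k

/-- `f` has SNR exponent `e`: `f` is eventually positive and `log f(ρ) / log ρ → e`. -/
def HasExponent (f : ℝ → ℝ) (e : ℝ) : Prop :=
  (∀ᶠ ρ in atTop, 0 < f ρ) ∧ Tendsto (fun ρ => Real.log (f ρ) / Real.log ρ) atTop (𝓝 e)

/-- Exponential equality `f ≐ g`. -/
def ExpEq (f g : ℝ → ℝ) : Prop := ∃ e, HasExponent f e ∧ HasExponent g e

/-- The diversity of a system with outage probability `p` is `d`: `- log p(ρ) / log ρ → d`. -/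
def HasDiversity (p : ℝ → ℝ) (d : ℝ) : Prop := HasExponent p (-d)

end PrecodedMIMO

end

namespace PrecodedMIMO

/-! Zero forcing removes all interference, so the SINR of stream k is `ρ / N` divided by a noise
gain `‖T‖² ‖row k of (H T)⁻¹‖²`, where `T` is the unnormalized precoder and `‖T‖` its Frobenius
norm. When `H Hᴴ` is invertible, `(H T)⁻¹` is `(H Hᴴ)⁻¹` for MF and `1 + c (H Hᴴ)⁻¹` for RZF. The
noise gain is therefore at most of order `λ_min⁻²`, up to a polynomial in `‖H‖`
(`HasNoiseGainBounds`). Outage needs a gain of order `ρ`, hence `λ_min` of order `ρ ^ (-1/2)`, which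
explains the factor 1/2 in the diversity.

The order `λ_min⁻²` is attained in every stream at once when a near-null combination of the rows has
all its coefficients bounded below (`IsNearlySingular`). The sum of all the rates is then small, and
outage occurs. So outage is squeezed between near singularity at scale `r ~ ρ ^ (-1/4)` and `λ_min ≤
K (1 + ‖H‖²) ρ ^ (-1/2)`.

Both events have probability `r ^ (2 (M - N + 1))` up to an arbitrarily small loss in the exponent.
From above: round the N - 1 free coefficients of a small combination to a net of about `(b / r) ^ (2
(N - 1))` points, where `b = ρ ^ δ` bounds the entries; each net point costs `r ^ (2 M)`. From
below: for the other entries in a fixed open set, M - N + 1 entries of one row need only fall in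
discs of radius `r`. -/

theorem HasExponent.of_bounds {f : ℝ → ℝ} {e : ℝ}
    (hlow : ∃ a > 0, ∀ᶠ ρ in atTop, a * ρ ^ e ≤ f ρ)
    (hup : ∀ ε > 0, ∃ C > 0, ∀ᶠ ρ in atTop, f ρ ≤ C * ρ ^ (e + ε)) : HasExponent f e := by
  obtain ⟨a, ha, hlow⟩ := hlow
  have hlog : ∀ b : ℝ, Tendsto (fun ρ : ℝ => Real.log b / Real.log ρ) atTop (𝓝 0) := fun b =>
    Tendsto.div_atTop tendsto_const_nhds Real.tendsto_log_atTop
  have hpos : ∀ᶠ ρ in atTop, 0 < f ρ := by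
    filter_upwards [hlow, eventually_gt_atTop 0] with ρ h h0
    exact lt_of_lt_of_le (by positivity) h
  have hexp : ∀ b > 0, ∀ s : ℝ, ∀ ρ > (1 : ℝ),
      Real.log (b * ρ ^ s) / Real.log ρ = Real.log b / Real.log ρ + s := by
    intro b hb s ρ hρ
    have h0 : 0 < ρ := by linarith
    have h1 := Real.log_pos hρ
    rw [Real.log_mul hb.ne' (by positivity), Real.log_rpow h0]
    field_simp
  refine ⟨hpos, tendsto_order.2 ⟨fun x hx => ?_, fun x hx => ?_⟩⟩
  · have h := ((hlog a).add_const e).eventually (lt_mem_nhds (a := x) (by simpa using hx))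
    filter_upwards [h, hlow, eventually_gt_atTop 1] with ρ h1 h2 h3
    rw [← hexp a ha e ρ h3] at h1
    have h4 := Real.log_pos h3
    have : 0 < a * ρ ^ e := by positivity
    refine h1.trans_le ?_
    gcongr
  -- Half of the gap pays for the loss in the exponent, the other half absorbs `log C / log ρ`.
  · obtain ⟨C, hC, hup⟩ := hup ((x - e) / 2) (by linarith)
    have h := ((hlog C).add_const (e + (x - e) / 2)).eventually
      (gt_mem_nhds (show 0 + (e + (x - e) / 2) < x by linarith))
    filter_upwards [h, hup, hpos, eventually_gt_atTop 1] with ρ h1 h2 h0 h3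
    rw [← hexp C hC _ ρ h3] at h1
    have h4 := Real.log_pos h3
    refine lt_of_le_of_lt ?_ h1
    gcongr

/-! ### Small-ball and tail estimates for the complex Gaussian -/

theorem gaussianReal_Icc_le (a r : ℝ) :
    gaussianReal 0 (1 / 2) (Set.Icc (a - r) (a + r)) ≤ ENNReal.ofReal (2 * r) := by
  rw [gaussianReal_apply _ (by norm_num)]
  calc ∫⁻ x in Set.Icc (a - r) (a + r), gaussianPDF 0 (1 / 2) x
      ≤ ∫⁻ x in Set.Icc (a - r) (a + r), 1 := by
        refine lintegral_mono fun x => ?_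
        rw [gaussianPDF_def, ← ENNReal.ofReal_one]
        refine ENNReal.ofReal_le_ofReal ?_
        rw [gaussianPDFReal]
        -- With variance 1/2 the density peaks at `1 / √π`.
        have h1 : (1 : ℝ) ≤ √(2 * Real.pi * ((1 / 2 : NNReal) : ℝ)) := by
          rw [Real.one_le_sqrt]
          push_cast
          nlinarith [Real.pi_gt_three]
        refine mul_le_one₀ (inv_le_one_of_one_le₀ h1) (Real.exp_nonneg _) ?_
        rw [Real.exp_le_one_iff]
        apply div_nonpos_of_nonpos_of_nonneg
        · nlinarith [sq_nonneg (x - 0)]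
        · positivity
    _ = ENNReal.ofReal (2 * r) := by
        rw [setLIntegral_one, Real.volume_Icc]
        congr 1
        ring

/-- The interval stays inside `|x| ≤ D + 1`, where the density is at least `exp (-(D + 1)²) / √π`.
-/
theorem exists_le_gaussianReal_Icc (D : ℝ) : ∃ c > 0, ∀ a r : ℝ, |a| ≤ D → 0 ≤ r → r ≤ 1 →
    ENNReal.ofReal (c * r) ≤ gaussianReal 0 (1 / 2) (Set.Icc (a - r) (a + r)) := by
  set c := (√(2 * Real.pi * ((1 / 2 : NNReal) : ℝ)))⁻¹ * Real.exp (-(D + 1) ^ 2) with hc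
  have hc0 : 0 < c := by
    rw [hc]
    have := Real.pi_pos
    have : (0 : ℝ) < ((1 / 2 : NNReal) : ℝ) := by norm_num
    positivity
  refine ⟨c, hc0, fun a r ha hr hr1 => ?_⟩
  rw [gaussianReal_apply _ (by norm_num)]
  calc ENNReal.ofReal (c * r) ≤ ∫⁻ x in Set.Icc (a - r) (a + r), ENNReal.ofReal c := by
        simp only [lintegral_const, MeasurableSet.univ, Measure.restrict_apply, Set.univ_inter,
          Real.volume_Icc]
        rw [← ENNReal.ofReal_mul hc0.le]
        refine ENNReal.ofReal_le_ofReal ?_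
        nlinarith
    _ ≤ _ := by
        refine setLIntegral_mono' measurableSet_Icc fun x hx => ?_
        rw [gaussianPDF_def]
        refine ENNReal.ofReal_le_ofReal ?_
        rw [gaussianPDFReal, hc]
        gcongr
        rw [le_div_iff₀ (by norm_num)]
        have h1 := abs_le.1 ha
        obtain ⟨h2, h3⟩ := hx
        have : |x| ≤ D + 1 := abs_le.2 ⟨by linarith, by linarith⟩
        have := sq_le_sq' (by linarith [abs_le.1 this]) (abs_le.1 this).2
        push_cast
        simp
        linarith

theorem measurable_ofReal_add_ofReal_mul_I :
    Measurable (fun p : ℝ × ℝ => (p.1 : ℂ) + (p.2 : ℂ) * Complex.I) := by fun_prop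

instance : IsProbabilityMeasure stdComplexGaussian :=
  Measure.isProbabilityMeasure_map measurable_ofReal_add_ofReal_mul_I.aemeasurable

instance : stdComplexGaussian.IsOpenPosMeasure := by
  have : (gaussianReal 0 (1 / 2)).IsOpenPosMeasure :=
    (gaussianReal_absolutelyContinuous' 0 (by norm_num)).isOpenPosMeasure
  refine Continuous.isOpenPosMeasure_map (by fun_prop) fun z => ⟨(z.re, z.im), ?_⟩
  exact Complex.re_add_im z

theorem stdComplexGaussian_closedBall_le (z : ℂ) {r : ℝ} (hr : 0 ≤ r) :
    stdComplexGaussian (Metric.closedBall z r) ≤ ENNReal.ofReal (4 * r ^ 2) := by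
  rw [stdComplexGaussian, Measure.map_apply measurable_ofReal_add_ofReal_mul_I
    Metric.isClosed_closedBall.measurableSet]
  calc _ ≤ ((gaussianReal 0 (1 / 2)).prod (gaussianReal 0 (1 / 2)))
        (Set.Icc (z.re - r) (z.re + r) ×ˢ Set.Icc (z.im - r) (z.im + r)) := by
        refine measure_mono fun p hp => ?_
        rw [Set.mem_preimage, mem_closedBall_iff_norm] at hp
        have h1 := abs_le.1 ((Complex.abs_re_le_norm _).trans hp)
        have h2 := abs_le.1 ((Complex.abs_im_le_norm _).trans hp)
        simp at h1 h2
        exact ⟨⟨by linarith, by linarith⟩, ⟨by linarith, by linarith⟩⟩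
    _ ≤ ENNReal.ofReal (2 * r) * ENNReal.ofReal (2 * r) := by
        rw [Measure.prod_prod]
        gcongr <;> exact gaussianReal_Icc_le _ _
    _ = _ := by
        rw [← ENNReal.ofReal_mul (by positivity)]
        congr 1
        ring

theorem exists_le_stdComplexGaussian_closedBall (D : ℝ) : ∃ c > 0, ∀ (z : ℂ) (r : ℝ), ‖z‖ ≤ D →
    0 ≤ r → r ≤ 1 → ENNReal.ofReal (c * r ^ 2) ≤ stdComplexGaussian (Metric.closedBall z r) := by
  obtain ⟨c, hc, h⟩ := exists_le_gaussianReal_Icc D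
  refine ⟨c ^ 2 / 4, by positivity, fun z r hz hr hr1 => ?_⟩
  rw [stdComplexGaussian, Measure.map_apply measurable_ofReal_add_ofReal_mul_I
    Metric.isClosed_closedBall.measurableSet]
  calc _ = ENNReal.ofReal (c * (r / 2)) * ENNReal.ofReal (c * (r / 2)) := by
        rw [← ENNReal.ofReal_mul (by positivity)]
        congr 1
        ring
    _ ≤ ((gaussianReal 0 (1 / 2)).prod (gaussianReal 0 (1 / 2)))
        (Set.Icc (z.re - r / 2) (z.re + r / 2) ×ˢ Set.Icc (z.im - r / 2) (z.im + r / 2)) := by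
        rw [Measure.prod_prod]
        gcongr
        · exact h _ _ ((Complex.abs_re_le_norm _).trans hz) (by linarith) (by linarith)
        · exact h _ _ ((Complex.abs_im_le_norm _).trans hz) (by linarith) (by linarith)
    _ ≤ _ := by
        refine measure_mono fun p hp => ?_
        obtain ⟨⟨h1, h2⟩, h3, h4⟩ := hp
        rw [Set.mem_preimage, mem_closedBall_iff_norm]
        refine (Complex.norm_le_abs_re_add_abs_im _).trans ?_
        simp
        have h5 : |p.1 - z.re| ≤ r / 2 := abs_le.2 ⟨by linarith, by linarith⟩
        have h6 : |p.2 - z.im| ≤ r / 2 := abs_le.2 ⟨by linarith, by linarith⟩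
        linarith

theorem memLp_id_stdComplexGaussian (p : NNReal) :
    MemLp (id : ℂ → ℂ) p stdComplexGaussian := by
  rw [stdComplexGaussian, memLp_map_measure_iff (by fun_prop)
    measurable_ofReal_add_ofReal_mul_I.aemeasurable]
  have h : MemLp (id : ℝ → ℝ) p (gaussianReal 0 (1 / 2)) := memLp_id_gaussianReal p
  have h1 := (h.comp_fst (gaussianReal 0 (1 / 2))).ofReal (K := ℂ)
  have h2 := ((h.comp_snd (gaussianReal 0 (1 / 2))).ofReal (K := ℂ)).mul_const Complex.I
  exact h1.add h2

/-- Polynomial tail bounds of every order. -/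
theorem exists_stdComplexGaussian_tail_le (p : ℕ) (hp : p ≠ 0) : ∃ C > 0, ∀ b > 0,
    stdComplexGaussian {z | b ≤ ‖z‖} ≤ ENNReal.ofReal (C * (b ^ p)⁻¹) := by
  have hmem := memLp_id_stdComplexGaussian p
  set K := eLpNorm (id : ℂ → ℂ) ((p : NNReal) : ENNReal) stdComplexGaussian ^ (p : ℝ) with hK
  have hKt : K ≠ ⊤ := (ENNReal.rpow_lt_top_of_nonneg (by positivity) hmem.2.ne).ne
  refine ⟨K.toReal + 1, by positivity, fun b hb => ?_⟩
  have h := meas_ge_le_mul_pow_eLpNorm_enorm (p := ((p : NNReal) : ENNReal)) stdComplexGaussian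
    (by simpa using hp) (by simp) hmem.1 (ε := ENNReal.ofReal b) (by simpa using hb) (by simp)
  have hset : {z : ℂ | b ≤ ‖z‖} = {z | ENNReal.ofReal b ≤ ‖id z‖ₑ} := by
    ext z
    simp only [Set.mem_ofPred_eq, id, ← ofReal_norm]
    rw [ENNReal.ofReal_le_ofReal_iff (norm_nonneg z)]
  rw [hset]
  refine h.trans ?_
  have e1 : (((p : NNReal) : ENNReal)).toReal = (p : ℝ) := by simp
  rw [e1, ← hK, ← ENNReal.ofReal_inv_of_pos hb, ENNReal.rpow_natCast,
    ← ENNReal.ofReal_pow (by positivity), inv_pow, mul_comm,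
    ENNReal.ofReal_mul (by positivity)]
  gcongr
  rw [← ENNReal.ofReal_toReal hKt]
  exact ENNReal.ofReal_le_ofReal (by simp)

/-! ### Conditioning on part of the coordinates of a product measure -/

section Fubini

variable {ι X : Type*} [Fintype ι] [MeasurableSpace X] (ν : Measure X) [IsProbabilityMeasure ν]
  (q : ι → Prop) [DecidablePred q]

/-- Combine coordinates in `q` with coordinates outside `q`. -/
def glue (y : {i // q i} → X) (x : {i // ¬ q i} → X) (i : ι) : X :=
  if h : q i then y ⟨i, h⟩ else x ⟨i, h⟩

theorem pi_apply_eq_lintegral_glue {E : Set (ι → X)} (hE : MeasurableSet E) :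
    Measure.pi (fun _ => ν) E = ∫⁻ x, Measure.pi (fun _ : {i // q i} => ν) {y | glue q y x ∈ E}
      ∂Measure.pi (fun _ : {i // ¬ q i} => ν) := by
  have h := (measurePreserving_piEquivPiSubtypeProd (fun _ : ι => ν) q).symm
  rw [← h.measure_preimage hE.nullMeasurableSet,
    Measure.prod_apply_symm (h.measurable hE)]
  rfl

theorem pi_le_of_forall_glue_le {E : Set (ι → X)} (hE : MeasurableSet E) {κ : ENNReal}
    (h : ∀ x, Measure.pi (fun _ : {i // q i} => ν) {y | glue q y x ∈ E} ≤ κ) :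
    Measure.pi (fun _ => ν) E ≤ κ := by
  rw [pi_apply_eq_lintegral_glue ν q hE]
  refine (lintegral_mono h).trans ?_
  simp

theorem le_pi_of_forall_le_glue {E : Set (ι → X)} (hE : MeasurableSet E) {κ : ENNReal}
    {U : Set ({i // ¬ q i} → X)} (hU : MeasurableSet U)
    (h : ∀ x ∈ U, κ ≤ Measure.pi (fun _ : {i // q i} => ν) {y | glue q y x ∈ E}) :
    κ * Measure.pi (fun _ => ν) U ≤ Measure.pi (fun _ => ν) E := by
  rw [pi_apply_eq_lintegral_glue ν q hE, ← setLIntegral_const]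
  exact (setLIntegral_mono' hU h).trans (setLIntegral_le_lintegral _ _)

end Fubini

end PrecodedMIMO

namespace PrecodedMIMO

theorem measurableSet_forall {α ι : Type*} [MeasurableSpace α] [Countable ι]
    {s : ι → α → Prop} (h : ∀ i, MeasurableSet {x | s i x}) :
    MeasurableSet {x | ∀ i, s i x} := by
  rw [Set.ofPred_forall]
  exact .iInter h

/-! ### Tubes around graphs: given the other coordinates, a product of discs -/

section Tube

variable {ι : Type*} (q : ι → Prop)

/-- The points whose coordinates in `q` are within `r` of a function of the other coordinates,
the latter lying in `U`. -/
def tube (U : Set ({i // ¬ q i} → ℂ)) (w : {i // q i} → ({i // ¬ q i} → ℂ) → ℂ) (r : ℝ) :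
    Set (ι → ℂ) :=
  {h | (fun p : {i // ¬ q i} => h p) ∈ U ∧
    ∀ p : {i // q i}, h p ∈ Metric.closedBall (w p fun p' => h p') r}

variable {U : Set ({i // ¬ q i} → ℂ)} {w : {i // q i} → ({i // ¬ q i} → ℂ) → ℂ}

theorem measurableSet_tube [Finite ι] (hU : MeasurableSet U) (hw : ∀ p, Measurable (w p)) (r : ℝ) :
    MeasurableSet (tube q U w r) := by
  have h1 : Measurable fun (h : ι → ℂ) (p : {i // ¬ q i}) => h p := by fun_prop
  refine (h1 hU).inter (measurableSet_forall fun p => ?_)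
  have h2 : Measurable fun h : ι → ℂ => dist (h p) (w p fun p' => h p') :=
    (measurable_pi_apply _).dist ((hw p).comp h1)
  exact measurableSet_le h2 measurable_const

variable [DecidablePred q]

theorem glue_of_pos {X : Type*} (y : {i // q i} → X) (x : {i // ¬ q i} → X) (p : {i // q i}) :
    glue q y x p = y p := dif_pos p.2

theorem glue_of_neg {X : Type*} (y : {i // q i} → X) (x : {i // ¬ q i} → X)
    (p : {i // ¬ q i}) : glue q y x p = x p := dif_neg p.2

theorem glue_mem_tube {x : {i // ¬ q i} → ℂ} (hx : x ∈ U) (r : ℝ) :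
    {y | glue q y x ∈ tube q U w r} = Set.univ.pi fun p => Metric.closedBall (w p x) r := by
  ext y
  have : (fun p : {i // ¬ q i} => glue q y x p) = x := funext fun p => glue_of_neg q y x p
  simp only [tube, Set.mem_ofPred_eq, this, hx, true_and, Set.mem_pi, Set.mem_univ, true_imp_iff,
    glue_of_pos]

variable [Fintype ι] (ν : Measure ℂ) [IsProbabilityMeasure ν]

theorem pi_tube_le (hw : ∀ p, Measurable (w p)) {r : ℝ} {κ : ENNReal}
    (h : ∀ z, ν (Metric.closedBall z r) ≤ κ) :
    Measure.pi (fun _ => ν) (tube q Set.univ w r) ≤ κ ^ Fintype.card {i // q i} := by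
  refine pi_le_of_forall_glue_le ν q (measurableSet_tube q .univ hw r) fun x => ?_
  rw [glue_mem_tube q (Set.mem_univ x), Measure.pi_pi]
  exact (Finset.prod_le_prod' fun p _ => h _).trans_eq (by simp)

theorem le_pi_tube (hU : MeasurableSet U) (hw : ∀ p, Measurable (w p)) {r : ℝ} {κ : ENNReal}
    (h : ∀ x ∈ U, ∀ p, κ ≤ ν (Metric.closedBall (w p x) r)) :
    κ ^ Fintype.card {i // q i} * Measure.pi (fun _ => ν) U ≤
      Measure.pi (fun _ => ν) (tube q U w r) := by
  refine le_pi_of_forall_le_glue ν q (measurableSet_tube q hU hw r) hU fun x hx => ?_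
  rw [glue_mem_tube q hx, Measure.pi_pi]
  exact (Finset.prod_le_prod' fun p _ => h x hx p).trans' (by simp)

end Tube

/-- The net of the unit disc: rounding real and imaginary parts down to multiples of `1 / n` costs
at most `1 / n` each. -/
theorem exists_gaussianInt_near {n : ℕ} (hn : n ≠ 0) {z : ℂ} (hz : ‖z‖ ≤ 1) :
    ∃ a ∈ Finset.Icc (-n : ℤ) n ×ˢ Finset.Icc (-n : ℤ) n,
      ‖z - ((a.1 : ℂ) + a.2 * Complex.I) / n‖ ≤ 2 / n := by
  have key : ∀ x : ℝ, |x| ≤ 1 → ∃ a ∈ Finset.Icc (-n : ℤ) n, |n * x - a| ≤ 1 := by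
    intro x hx
    have hn' : (0 : ℝ) < n := by positivity
    obtain ⟨h1, h2⟩ := abs_le.1 hx
    refine ⟨⌊n * x⌋, Finset.mem_Icc.2 ⟨?_, ?_⟩, ?_⟩
    · rw [Int.le_floor]; push_cast; nlinarith
    · have := Int.floor_le (n * x)
      have h3 : (⌊n * x⌋ : ℝ) ≤ (n : ℝ) := by nlinarith
      exact_mod_cast h3
    · rw [abs_le]
      constructor <;> linarith [Int.floor_le (n * x), Int.lt_floor_add_one (n * x)]
  obtain ⟨a, ha, ha'⟩ := key z.re ((Complex.abs_re_le_norm z).trans hz)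
  obtain ⟨b, hb, hb'⟩ := key z.im ((Complex.abs_im_le_norm z).trans hz)
  refine ⟨(a, b), Finset.mem_product.2 ⟨ha, hb⟩, ?_⟩
  have hn' : (n : ℂ) ≠ 0 := by exact_mod_cast hn
  have e : z - ((a : ℂ) + b * Complex.I) / n = (n * z - (a + b * Complex.I)) / n := by
    field_simp
  rw [e, norm_div, Complex.norm_natCast]
  gcongr
  refine (Complex.norm_le_abs_re_add_abs_im _).trans ?_
  simp
  linarith

/-! ### Upper bound for the probability of a small combination of rows -/

section Rayleigh

variable {Ω : Type*} [MeasurableSpace Ω] {P : Measure Ω} {N M : ℕ}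
  {H : Ω → Matrix (Fin N) (Fin M) ℂ}

theorem IsRayleighChannel.aemeasurable (hH : IsRayleighChannel P H) :
    AEMeasurable (fun ω (p : Fin N × Fin M) => H ω p.1 p.2) P :=
  aemeasurable_pi_lambda _ fun p => (hH.hasLaw p.1 p.2).aemeasurable

theorem IsRayleighChannel.measure_exists_entry_le (hH : IsRayleighChannel P H) (p : ℕ)
    (hp : p ≠ 0) : ∃ C > 0, ∀ b > 0,
      P {ω | ∃ i j, b ≤ ‖H ω i j‖} ≤ ENNReal.ofReal (C * (b ^ p)⁻¹) := by
  obtain ⟨C, hC, h⟩ := exists_stdComplexGaussian_tail_le p hp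
  refine ⟨(N * M + 1) * C, by positivity, fun b hb => ?_⟩
  have e : {ω | ∃ i j, b ≤ ‖H ω i j‖} =
      ⋃ q ∈ (Finset.univ : Finset (Fin N × Fin M)), {ω | b ≤ ‖H ω q.1 q.2‖} := by
    ext ω; simp
  rw [e]
  refine (measure_biUnion_finset_le _ _).trans ?_
  have h1 : ∀ q : Fin N × Fin M, P {ω | b ≤ ‖H ω q.1 q.2‖} ≤ ENNReal.ofReal (C * (b ^ p)⁻¹) := by
    intro q
    refine le_trans (le_of_eq ?_) (h b hb)
    rw [← (hH.hasLaw q.1 q.2).map_eq, Measure.map_apply_of_aemeasurable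
      (hH.hasLaw q.1 q.2).aemeasurable (measurableSet_le measurable_const measurable_norm)]
    rfl
  refine (Finset.sum_le_sum fun q _ => h1 q).trans ?_
  rw [Finset.sum_const, nsmul_eq_mul, ← ENNReal.ofReal_natCast,
    ← ENNReal.ofReal_mul (by positivity), mul_assoc]
  refine ENNReal.ofReal_le_ofReal ?_
  have : (0 : ℝ) ≤ C * (b ^ p)⁻¹ := by positivity
  gcongr
  simp

variable [IsProbabilityMeasure P]

theorem IsRayleighChannel.map_eq (hH : IsRayleighChannel P H) :
    P.map (fun ω (p : Fin N × Fin M) => H ω p.1 p.2) =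
      Measure.pi fun _ => stdComplexGaussian := by
  rw [(iIndepFun_iff_map_fun_eq_pi_map fun p : Fin N × Fin M =>
    (hH.hasLaw p.1 p.2).aemeasurable).1 hH.indep]
  congr 1
  ext1 p
  exact (hH.hasLaw p.1 p.2).map_eq

theorem IsRayleighChannel.measure_mem (hH : IsRayleighChannel P H)
    {E : Set (Fin N × Fin M → ℂ)} (hE : MeasurableSet E) :
    P {ω | (fun p : Fin N × Fin M => H ω p.1 p.2) ∈ E} =
      Measure.pi (fun _ => stdComplexGaussian) E := by
  rw [← hH.map_eq, Measure.map_apply_of_aemeasurable hH.aemeasurable hE]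
  rfl

/-- Given the other rows, each of the M entries of row `k` is confined to a disc of radius `r` about
a determined centre. -/
theorem IsRayleighChannel.measure_combination_le (hH : IsRayleighChannel P H) (k : Fin N)
    (v : {i // i ≠ k} → ℂ) {r : ℝ} (hr : 0 ≤ r) :
    P {ω | ∀ j, ‖H ω k j + ∑ i, v i * H ω i j‖ ≤ r} ≤ ENNReal.ofReal (4 * r ^ 2) ^ M := by
  let q : Fin N × Fin M → Prop := fun p => p.1 = k
  let w : {p // q p} → ({p // ¬ q p} → ℂ) → ℂ := fun p x =>
    -∑ i : {i // i ≠ k}, v i * x ⟨(i, p.1.2), i.2⟩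
  have hw : ∀ p, Measurable (w p) := fun p => by fun_prop
  have hcard : Fintype.card {p // q p} = M := by
    rw [Fintype.card_subtype]
    have : (Finset.univ.filter q) = {k} ×ˢ (Finset.univ : Finset (Fin M)) := by
      ext ⟨i, j⟩; simp [q, eq_comm]
    rw [this]; simp
  have h := pi_tube_le q stdComplexGaussian hw (r := r)
    fun z => stdComplexGaussian_closedBall_le z hr
  rw [hcard, ← hH.measure_mem (measurableSet_tube q .univ hw r)] at h
  refine le_trans (measure_mono fun ω hω => ?_) h
  refine ⟨trivial, fun p => ?_⟩
  obtain ⟨⟨i, j⟩, hp : i = k⟩ := p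
  simpa [w, hp, dist_eq_norm] using hω j

/-- A union bound over `k` and over a net for the N - 1 coefficients other than `v k = 1`. Fixing
one coefficient keeps the net dimension at N - 1 and so gives the sharp exponent. -/
theorem IsRayleighChannel.exists_measure_small_combination_le (hH : IsRayleighChannel P H) :
    ∃ C > (0 : ℝ), ∀ r b : ℝ, 0 < r → r ≤ b →
      P {ω | (∀ i j, ‖H ω i j‖ ≤ b) ∧ ∃ k, ∃ v : Fin N → ℂ, v k = 1 ∧ (∀ i, ‖v i‖ ≤ 1) ∧
        ∀ j, ‖∑ i, v i * H ω i j‖ ≤ r} ≤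
      ENNReal.ofReal (C * ((b / r) ^ 2) ^ (N - 1) * (r ^ 2) ^ M) := by
  refine ⟨(N + 1) * 36 ^ (N - 1) * (4 * (2 * N + 1) ^ 2) ^ M, by positivity,
    fun r b hr hrb => ?_⟩
  have hb : 0 < b := hr.trans_le hrb
  -- With this mesh, rounding a coefficient moves its term by at most `(2 / n) b ≤ 2 r`, so the
  -- rounded combination is at most `(2 N + 1) r`.
  set n := ⌈b / r⌉₊ with hn
  have hbr : 1 ≤ b / r := (one_le_div hr).2 hrb
  have hnge : b / r ≤ n := Nat.le_ceil _
  have hn0 : n ≠ 0 := by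
    rintro h0
    rw [h0] at hnge
    norm_num at hnge
    linarith
  have hnle : (n : ℝ) ≤ 2 * (b / r) := by
    have := (Nat.ceil_lt_add_one (by positivity : 0 ≤ b / r)).le
    linarith
  have hnb : b / n ≤ r := by
    rw [div_le_iff₀ hr] at hnge
    rw [div_le_iff₀ (by positivity)]
    linarith
  let D : Finset (ℤ × ℤ) := Finset.Icc (-n : ℤ) n ×ˢ Finset.Icc (-n : ℤ) n
  let g : ℤ × ℤ → ℂ := fun a => ((a.1 : ℂ) + a.2 * Complex.I) / n
  let F : (k : Fin N) → ({i // i ≠ k} → ℤ × ℤ) → Set Ω := fun k a =>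
    {ω | ∀ j, ‖H ω k j + ∑ i, g (a i) * H ω i j‖ ≤ (2 * N + 1) * r}
  have hF : ∀ k a, P (F k a) ≤ ENNReal.ofReal (4 * ((2 * N + 1) * r) ^ 2) ^ M := fun k a =>
    hH.measure_combination_le k _ (by positivity)
  have hsub : {ω | (∀ i j, ‖H ω i j‖ ≤ b) ∧ ∃ k, ∃ v : Fin N → ℂ, v k = 1 ∧ (∀ i, ‖v i‖ ≤ 1) ∧
        ∀ j, ‖∑ i, v i * H ω i j‖ ≤ r} ⊆
      ⋃ k ∈ (Finset.univ : Finset (Fin N)), ⋃ a ∈ Fintype.piFinset fun _ : {i // i ≠ k} => D,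
        F k a := by
    rintro ω ⟨hωb, k, v, hvk, hv, hvr⟩
    choose a ha ha' using fun i : {i // i ≠ k} => exists_gaussianInt_near hn0 (hv i)
    simp only [Set.mem_iUnion]
    refine ⟨k, Finset.mem_univ _, a, Fintype.mem_piFinset.2 ha, fun j => ?_⟩
    have e1 : ∑ i, v i * H ω i j = H ω k j + ∑ i : {i // i ≠ k}, v i * H ω i j := by
      rw [Fintype.sum_eq_add_sum_subtype_ne _ k, hvk, one_mul]
    have e2 : H ω k j + ∑ i, g (a i) * H ω i j =
        ∑ i, v i * H ω i j - ∑ i : {i // i ≠ k}, (v i - g (a i)) * H ω i j := by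
      rw [e1]
      simp only [sub_mul, Finset.sum_sub_distrib]
      ring
    rw [e2]
    refine (norm_sub_le _ _).trans ?_
    have h3 : ‖∑ i : {i // i ≠ k}, (v i - g (a i)) * H ω i j‖ ≤ N * (2 * r) := by
      refine (norm_sum_le _ _).trans ?_
      refine (Finset.sum_le_card_nsmul _ _ (2 * r) fun i _ => ?_).trans ?_
      · rw [norm_mul]
        calc _ ≤ 2 / n * b := by
              gcongr
              · exact ha' i
              · exact hωb _ _
          _ = 2 * (b / n) := by ring
          _ ≤ _ := by gcongr
      · rw [nsmul_eq_mul]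
        gcongr
        rw [Finset.card_univ]
        exact (Fintype.card_subtype_le _).trans_eq (Fintype.card_fin N)
    linarith [hvr j]
  have hcardD : (D.card : ℝ) ≤ 36 * (b / r) ^ 2 := by
    have : D.card = (2 * n + 1) ^ 2 := by
      simp only [D, Finset.card_product, Int.card_Icc]
      rw [show ((n : ℤ) + 1 - -n).toNat = 2 * n + 1 by omega]
      ring
    rw [this]
    have : (1 : ℝ) ≤ n := by exact_mod_cast Nat.one_le_iff_ne_zero.2 hn0
    have h6 : (2 * n + 1 : ℝ) ≤ 6 * (b / r) := by linarith
    push_cast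
    calc (2 * n + 1 : ℝ) ^ 2 ≤ (6 * (b / r)) ^ 2 := by gcongr
      _ = _ := by ring
  refine (measure_mono hsub).trans ?_
  calc _ ≤ ∑ k : Fin N, ∑ a ∈ Fintype.piFinset fun _ : {i // i ≠ k} => D, P (F k a) :=
        (measure_biUnion_finset_le _ _).trans
          (Finset.sum_le_sum fun k _ => measure_biUnion_finset_le _ _)
    _ ≤ ∑ k : Fin N, ((Fintype.piFinset fun _ : {i // i ≠ k} => D).card : ENNReal) *
          ENNReal.ofReal (4 * ((2 * N + 1) * r) ^ 2) ^ M := by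
        refine Finset.sum_le_sum fun k _ => ?_
        rw [← nsmul_eq_mul]
        exact Finset.sum_le_card_nsmul _ _ _ fun a _ => hF k a
    _ = ENNReal.ofReal (N * (D.card ^ (N - 1) * (4 * ((2 * N + 1) * r) ^ 2) ^ M)) := by
        have : ∀ k : Fin N, (Fintype.piFinset fun _ : {i // i ≠ k} => D).card =
            D.card ^ (N - 1) := by
          intro k
          rw [Fintype.card_piFinset, Finset.prod_const, Finset.card_univ]
          simp [Fintype.card_subtype_compl]
        simp only [this]
        rw [Finset.sum_const, nsmul_eq_mul, Finset.card_univ, Fintype.card_fin,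
          ENNReal.ofReal_mul (Nat.cast_nonneg N),
          ENNReal.ofReal_mul (pow_nonneg (Nat.cast_nonneg D.card) _),
          ENNReal.ofReal_pow (by positivity : 0 ≤ 4 * ((2 * (N : ℝ) + 1) * r) ^ 2), ENNReal.ofReal_pow (Nat.cast_nonneg _)]
        simp
    _ ≤ _ := by
        refine ENNReal.ofReal_le_ofReal ?_
        calc (N * (D.card ^ (N - 1) * (4 * ((2 * N + 1) * r) ^ 2) ^ M) : ℝ)
            ≤ (N + 1) * ((36 * (b / r) ^ 2) ^ (N - 1) * (4 * ((2 * N + 1) * r) ^ 2) ^ M) := by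
              gcongr
              linarith
          _ = _ := by
              rw [mul_pow, show 4 * ((2 * N + 1) * r) ^ 2 = (4 * (2 * N + 1 : ℝ) ^ 2) * r ^ 2 by
                ring, mul_pow]
              ring

end Rayleigh

end PrecodedMIMO

/-! ### Lower bound for the probability of near singularity -/

namespace PrecodedMIMO

theorem measurable_matrix_inv_apply {n : Type*} [Fintype n] [DecidableEq n] (i j : n) :
    Measurable fun A : n → n → ℂ => (Matrix.of A)⁻¹ i j := by
  have h1 : Continuous fun A : n → n → ℂ => (Matrix.of A).det :=
    Continuous.matrix_det continuous_id
  have h2 : Continuous fun A : n → n → ℂ => (Matrix.of A).adjugate i j :=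
    (Continuous.matrix_adjugate continuous_id).matrix_elem i j
  simp only [Matrix.inv_def, Ring.inverse_eq_inv', Matrix.smul_apply, smul_eq_mul]
  exact h1.measurable.inv.mul h2.measurable

theorem continuousAt_matrix_inv_apply {n : Type*} [Fintype n] [DecidableEq n]
    {A : n → n → ℂ} (hA : (Matrix.of A).det ≠ 0) (i j : n) :
    ContinuousAt (fun A : n → n → ℂ => (Matrix.of A)⁻¹ i j) A := by
  have h1 : Continuous fun A : n → n → ℂ => (Matrix.of A).det :=
    Continuous.matrix_det continuous_id
  have h2 : Continuous fun A : n → n → ℂ => (Matrix.of A).adjugate i j :=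
    (Continuous.matrix_adjugate continuous_id).matrix_elem i j
  simp only [Matrix.inv_def, Ring.inverse_eq_inv', Matrix.smul_apply, smul_eq_mul]
  exact (h1.continuousAt.inv₀ hA).mul h2.continuousAt

/-- A bounded channel with an entry bounded below, for which some combination of the rows with
coefficients bounded below, one of them `1`, has entries at most `r`. -/
def IsNearlySingular {N M : ℕ} (a B r : ℝ) (H : Matrix (Fin N) (Fin M) ℂ) : Prop :=
  (∀ i j, ‖H i j‖ ≤ B) ∧ (∃ i j, a ≤ ‖H i j‖) ∧
    ∃ v : Fin N → ℂ, (∃ i, v i = 1) ∧ (∀ i, a ≤ ‖v i‖) ∧ ∀ j, ‖∑ i, v i * H i j‖ ≤ r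

/-- Choose coefficients `v` on the rows other than `k` that cancel row `k` exactly in N - 1 pivot
columns, by solving a square system. The M - N + 1 remaining entries of row `k` then have to lie
within `r` of the values that would cancel there too. -/
theorem IsRayleighChannel.exists_le_measure_isNearlySingular {Ω : Type*} [MeasurableSpace Ω]
    {P : Measure Ω} [IsProbabilityMeasure P] {N M : ℕ} (hN : 2 ≤ N) (hNM : N ≤ M)
    {H : Ω → Matrix (Fin N) (Fin M) ℂ} (hH : IsRayleighChannel P H) :
    ∃ c > (0 : ℝ), ∃ a > (0 : ℝ), ∃ B > (0 : ℝ), ∀ r, 0 < r → r ≤ 1 →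
      ENNReal.ofReal (c * (r ^ 2) ^ (M + 1 - N)) ≤ P {ω | IsNearlySingular a B r (H ω)} := by
  let k : Fin N := ⟨0, by omega⟩
  let I := {i : Fin N // i ≠ k}
  let e : Fin N → Fin M := Fin.castLE hNM
  have he : Function.Injective e := Fin.castLE_injective hNM
  -- The coordinates put in discs: row `k` outside the pivot columns `e i`.
  let q : Fin N × Fin M → Prop := fun p => p.1 = k ∧ ∀ i : I, p.2 ≠ e i
  have : DecidablePred q := Classical.decPred q
  have hq0 : ∀ (i : I) j, ¬ q (i, j) := fun i j h => i.2 h.1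
  have hq1 : ∀ (i : Fin N) (j : I), ¬ q (i, e j) := fun i j h => h.2 j rfl
  let X := {p // ¬ q p} → ℂ
  let K : X → I → I → ℂ := fun x i j => x ⟨(i, e j), hq1 i j⟩
  let ξ : X → I → ℂ := fun x j => x ⟨(k, e j), hq1 k j⟩
  -- The solution of `v K = -ξ`, with `K` the pivot block of the other rows and `ξ` the pivot
  -- entries of row `k`.
  let v : X → I → ℂ := fun x i => -∑ j, ξ x j * (Matrix.of (K x))⁻¹ j i
  let w : {p // q p} → X → ℂ := fun p x => -∑ i : I, v x i * x ⟨(i, p.1.2), hq0 i _⟩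
  have hξc : ∀ j, Continuous fun x => ξ x j := fun j => continuous_apply _
  have hKc : Continuous K := by fun_prop
  have hvm : ∀ i, Measurable fun x => v x i := fun i =>
    (Finset.measurable_sum _ fun j _ =>
      (hξc j).measurable.mul ((measurable_matrix_inv_apply j i).comp hKc.measurable)).neg
  have hwm : ∀ p, Measurable (w p) := fun p =>
    (Finset.measurable_sum _ fun i _ => (hvm i).mul (measurable_pi_apply _)).neg
  let U : Set X := {x | (Matrix.of (K x)).det ≠ 0 ∧ (∀ i, 1 / 2 < ‖v x i‖ ∧ ‖v x i‖ < 2) ∧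
    (∀ p, ‖x p‖ < 2) ∧ ∀ j, 1 / 2 < ‖ξ x j‖}
  have hdetc : Continuous fun x => (Matrix.of (K x)).det := Continuous.matrix_det hKc
  have hUm : MeasurableSet U := by
    refine MeasurableSet.inter (hdetc.measurable (measurableSet_singleton 0).compl) ?_
    refine MeasurableSet.inter (measurableSet_forall fun i => ?_) ?_
    · exact (measurableSet_lt measurable_const (hvm i).norm).inter
        (measurableSet_lt (hvm i).norm measurable_const)
    refine MeasurableSet.inter (measurableSet_forall fun p => ?_) (measurableSet_forall fun j => ?_)
    · exact measurableSet_lt (measurable_pi_apply p).norm measurable_const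
    · exact measurableSet_lt measurable_const (hξc j).measurable.norm
  -- At this point `K = 1` and every `v i = 1`, so the open conditions defining `U` hold near it;
  -- full support of the Gaussian gives `U` positive measure.
  let x₀ : X := fun p => if p.1.1 = k then -1 else if e p.1.1 = p.1.2 then 1 else 0
  have hK₀ : Matrix.of (K x₀) = 1 := by
    ext i j
    have hij : i.1 = j.1 ↔ i = j := Subtype.ext_iff.symm
    simp [K, x₀, Matrix.one_apply, he.eq_iff, hij, i.2]
  have hξ₀ : ∀ j, ξ x₀ j = -1 := fun j => by simp [ξ, x₀]
  have hv₀ : ∀ i, v x₀ i = 1 := fun i => by simp [v, hK₀, hξ₀, Matrix.one_apply]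
  have hvc : ∀ i, ContinuousAt (fun x => v x i) x₀ := fun i =>
    (tendsto_finsetSum _ fun j _ => ((hξc j).continuousAt (x := x₀)).mul
      (ContinuousAt.comp (f := K) (continuousAt_matrix_inv_apply (by rw [hK₀]; simp) j i)
        hKc.continuousAt)).neg
  have hU : U ∈ 𝓝 x₀ := by
    have h1 : ∀ᶠ x in 𝓝 x₀, (Matrix.of (K x)).det ≠ 0 :=
      hdetc.continuousAt.eventually_ne (by rw [hK₀]; simp)
    have h2 : ∀ i, ∀ᶠ x in 𝓝 x₀, 1 / 2 < ‖v x i‖ ∧ ‖v x i‖ < 2 := fun i =>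
      ((hvc i).norm.eventually (lt_mem_nhds (by simp only [hv₀]; norm_num))).and
        ((hvc i).norm.eventually (gt_mem_nhds (by simp only [hv₀]; norm_num)))
    have h3 : ∀ p, ∀ᶠ x : X in 𝓝 x₀, ‖x p‖ < 2 := fun p =>
      (continuous_apply p).norm.continuousAt.eventually (gt_mem_nhds (by
        simp only [x₀]
        split_ifs <;> simp))
    have h4 : ∀ j, ∀ᶠ x in 𝓝 x₀, 1 / 2 < ‖ξ x j‖ := fun j =>
      (hξc j).norm.continuousAt.eventually (lt_mem_nhds (by simp only [hξ₀]; norm_num))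
    exact h1.and ((eventually_all.2 h2).and ((eventually_all.2 h3).and (eventually_all.2 h4)))
  have hU0 : Measure.pi (fun _ => stdComplexGaussian) U ≠ 0 :=
    (Measure.measure_pos_of_mem_nhds _ hU).ne'
  have hw : ∀ x ∈ U, ∀ p, ‖w p x‖ ≤ 4 * N := by
    rintro x ⟨-, hx1, hx2, -⟩ p
    simp only [w, norm_neg]
    refine (norm_sum_le _ _).trans ((Finset.sum_le_card_nsmul _ _ 4 fun i _ => ?_).trans ?_)
    · rw [norm_mul]
      calc _ ≤ (2 : ℝ) * 2 := by
            gcongr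
            · exact (hx1 i).2.le
            · exact (hx2 _).le
        _ = 4 := by norm_num
    · rw [nsmul_eq_mul, mul_comm]
      gcongr
      rw [Finset.card_univ]
      exact (Fintype.card_subtype_le _).trans_eq (Fintype.card_fin N)
  have hcard : Fintype.card {p // q p} = M + 1 - N := by
    have : (Finset.univ.filter q) =
        {k} ×ˢ ((Finset.univ : Finset I).image fun i : I => e i)ᶜ := by
      ext ⟨i, j⟩
      simp only [q, Finset.mem_filter, Finset.mem_univ, true_and, Finset.mem_product,
        Finset.mem_singleton, Finset.mem_compl, Finset.mem_image, not_exists]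
      exact and_congr_right fun _ => forall_congr' fun _ => ne_comm
    have hinj : Function.Injective fun i : I => e i := he.comp Subtype.val_injective
    rw [Fintype.card_subtype, this, Finset.card_product, Finset.card_compl,
      Finset.card_image_of_injective _ hinj]
    simp [I, Fintype.card_subtype_compl]
    omega
  obtain ⟨c, hc, hball⟩ := exists_le_stdComplexGaussian_closedBall (4 * N)
  refine ⟨c ^ (M + 1 - N) * (Measure.pi (fun _ => stdComplexGaussian) U).toReal, mul_pos
    (by positivity) (ENNReal.toReal_pos hU0 (measure_ne_top _ _)), 1 / 2, by norm_num,
    4 * N + 2, by positivity, fun r hr hr1 => ?_⟩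
  have h := le_pi_tube q stdComplexGaussian hUm hwm (r := r) (κ := ENNReal.ofReal (c * r ^ 2))
    fun x hx p => hball _ r (hw x hx p) hr.le hr1
  rw [hcard, ← hH.measure_mem (measurableSet_tube q hUm hwm r)] at h
  refine le_trans (le_of_eq ?_) (h.trans (measure_mono ?_))
  · rw [mul_right_comm, ← mul_pow, ENNReal.ofReal_mul (by positivity),
      ENNReal.ofReal_pow (by positivity), ENNReal.ofReal_toReal (measure_ne_top _ _)]
  · rintro ω ⟨hωU, hωw⟩
    set x : X := fun p => H ω p.1.1 p.1.2 with hx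
    have hωU' := hωU
    obtain ⟨hdet, hv, hx2, hξ⟩ := hωU'
    refine ⟨fun i j => ?_, ?_, fun i => if h : i = k then 1 else v x ⟨i, h⟩,
      ⟨k, dif_pos rfl⟩, fun i => ?_, fun j => ?_⟩
    · by_cases h : q (i, j)
      · have h1 := hωw ⟨(i, j), h⟩
        rw [mem_closedBall_iff_norm] at h1
        have h2 := hw x hωU ⟨(i, j), h⟩
        have h3 := norm_le_norm_add_norm_sub' (H ω i j) (w ⟨(i, j), h⟩ x)
        change ‖H ω i j - w ⟨(i, j), h⟩ x‖ ≤ r at h1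
        linarith
      · have := hx2 ⟨(i, j), h⟩
        have : ‖H ω i j‖ < 2 := this
        have : (0 : ℝ) ≤ N := by positivity
        linarith
    -- A pivot column exists because `2 ≤ N`; its entry in row `k` exceeds 1/2.
    · let i₁ : I := ⟨⟨1, by omega⟩, by simp [k]⟩
      exact ⟨k, e i₁, (hξ i₁).le⟩
    · by_cases h : i = k
      · simp [h]
        norm_num
      · simpa [h] using (hv ⟨i, h⟩).1.le
    · rw [Fintype.sum_eq_add_sum_subtype_ne _ k]
      have e1 : ∀ i : I, (if h : i.1 = k then 1 else v x ⟨i, h⟩) * H ω i j = v x i * H ω i j :=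
        fun i => by rw [dif_neg i.2]
      simp only [e1, dite_true, one_mul]
      by_cases h : q (k, j)
      · have h1 := hωw ⟨(k, j), h⟩
        rw [mem_closedBall_iff_norm] at h1
        simpa [w] using h1
      · obtain ⟨j', rfl⟩ : ∃ j' : I, j = e j' := by
          simpa [q] using h
        have h1 : ∑ i : I, v x i * H ω i (e j') = -ξ x j' := by
          have h2 : v x = -(ξ x ᵥ* (Matrix.of (K x))⁻¹) := by
            ext i; simp [v, Matrix.vecMul, dotProduct]
          have h3 : v x ᵥ* Matrix.of (K x) = -ξ x := by
            rw [h2, Matrix.neg_vecMul, Matrix.vecMul_vecMul,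
              Matrix.nonsing_inv_mul _ (isUnit_iff_ne_zero.2 hdet), Matrix.vecMul_one]
          exact congrFun h3 j'
        rw [h1]
        simp [ξ, hx, hr.le]

end PrecodedMIMO

namespace PrecodedMIMO

/-! ### The smallest eigenvalue and columns of the inverse Gram matrix -/

section SqNorm

variable {ι : Type*} [Fintype ι]

/-- The squared Euclidean norm of a complex vector. -/
noncomputable def sqNorm (x : ι → ℂ) : ℝ := ∑ i, ‖x i‖ ^ 2

theorem sqNorm_nonneg (x : ι → ℂ) : 0 ≤ sqNorm x := by unfold sqNorm; positivity

theorem norm_sq_le_sqNorm (x : ι → ℂ) (i : ι) : ‖x i‖ ^ 2 ≤ sqNorm x :=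
  Finset.single_le_sum (f := fun i => ‖x i‖ ^ 2) (fun _ _ => by positivity) (Finset.mem_univ i)

theorem sqNorm_star (x : ι → ℂ) : sqNorm (star x) = sqNorm x := by simp [sqNorm]

theorem star_dotProduct_self (x : ι → ℂ) : star x ⬝ᵥ x = (sqNorm x : ℂ) := by
  simp only [dotProduct, sqNorm, Pi.star_apply, Complex.ofReal_sum, Complex.ofReal_pow]
  exact Finset.sum_congr rfl fun i _ => Complex.conj_mul' (x i)

theorem norm_star_dotProduct_sq_le (x y : ι → ℂ) :
    ‖star x ⬝ᵥ y‖ ^ 2 ≤ sqNorm x * sqNorm y := by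
  refine le_trans ?_ (Finset.sum_mul_sq_le_sq_mul_sq Finset.univ (fun i => ‖x i‖) fun i => ‖y i‖)
  gcongr
  refine (norm_sum_le _ _).trans_eq ?_
  simp

theorem sqNorm_eq_zero {x : ι → ℂ} : sqNorm x = 0 ↔ x = 0 := by
  unfold sqNorm
  rw [Finset.sum_eq_zero_iff_of_nonneg fun _ _ => by positivity]
  simp [funext_iff]

theorem sqNorm_eq_norm_sq (x : EuclideanSpace ℂ ι) : sqNorm x.ofLp = ‖x‖ ^ 2 := by
  rw [EuclideanSpace.norm_sq_eq]
  rfl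

end SqNorm

variable {N M : ℕ} (H : Matrix (Fin N) (Fin M) ℂ)

theorem star_dotProduct_gram_mulVec (x y : Fin N → ℂ) :
    star x ⬝ᵥ (H * Hᴴ) *ᵥ y = star (Hᴴ *ᵥ x) ⬝ᵥ (Hᴴ *ᵥ y) := by
  rw [← Matrix.mulVec_mulVec, Matrix.dotProduct_mulVec, Matrix.star_mulVec,
    Matrix.conjTranspose_conjTranspose]

theorem lambdaMin_mul_sqNorm_le (x : Fin N → ℂ) :
    lambdaMin H * sqNorm x ≤ sqNorm (Hᴴ *ᵥ x) := by
  set hA := Matrix.isHermitian_mul_conjTranspose_self H with hAdef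
  set b := hA.eigenvectorBasis with hb
  set X : EuclideanSpace ℂ (Fin N) := WithLp.toLp 2 x with hX
  have h1 : sqNorm x = ∑ i, ‖b.repr X i‖ ^ 2 := by
    have h := sqNorm_eq_norm_sq X
    rw [← b.repr.norm_map, EuclideanSpace.norm_sq_eq] at h
    exact h
  have h2 : (sqNorm (Hᴴ *ᵥ x) : ℂ) = ∑ i, (hA.eigenvalues i * ‖b.repr X i‖ ^ 2 : ℝ) := by
    rw [← star_dotProduct_self, ← star_dotProduct_gram_mulVec]
    have e1 : x = ∑ i, b.repr X i • (b i).ofLp := by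
      have h := congrArg WithLp.ofLp (b.sum_repr X)
      rw [WithLp.ofLp_sum] at h
      exact h.symm
    have e2 : (H * Hᴴ) *ᵥ x = ∑ i, (b.repr X i * hA.eigenvalues i) • (b i).ofLp := by
      conv_lhs => rw [e1]
      rw [Matrix.mulVec_sum]
      refine Finset.sum_congr rfl fun i _ => ?_
      rw [Matrix.mulVec_smul, hb, hA.mulVec_eigenvectorBasis, mul_smul]
      rfl
    rw [e2, dotProduct_sum]
    push_cast
    refine Finset.sum_congr rfl fun i _ => ?_
    have e3 : star x ⬝ᵥ (b i).ofLp = star (b.repr X i) := by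
      rw [b.repr_apply_apply, ← dotProduct_comm]
      simp [EuclideanSpace.inner_eq_star_dotProduct, hX, dotProduct, mul_comm]
    rw [dotProduct_smul, e3, smul_eq_mul, ← Complex.mul_conj']
    simp only [starRingEnd_apply]
    ring
  have h3 : sqNorm (Hᴴ *ᵥ x) = ∑ i, hA.eigenvalues i * ‖b.repr X i‖ ^ 2 := by
    exact_mod_cast h2
  rw [h1, h3, Finset.mul_sum]
  gcongr with i
  exact ciInf_le (Set.finite_range _).bddBelow i

theorem exists_sqNorm_conjTranspose_mulVec_eq [NeZero N] :
    ∃ x : Fin N → ℂ, sqNorm x = 1 ∧ sqNorm (Hᴴ *ᵥ x) = lambdaMin H := by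
  set hA := Matrix.isHermitian_mul_conjTranspose_self H
  obtain ⟨i, hi⟩ := exists_eq_ciInf_of_finite (f := hA.eigenvalues)
  refine ⟨(hA.eigenvectorBasis i).ofLp, ?_, ?_⟩
  · rw [sqNorm_eq_norm_sq, hA.eigenvectorBasis.norm_eq_one]
    norm_num
  · have h := hA.eigenvalues_eq i
    rw [star_dotProduct_gram_mulVec, star_dotProduct_self] at h
    rw [lambdaMin, ← hi, h]
    simp

/-- Take a unit eigenvector for `λ_min`, conjugate it and divide by its largest entry. That entry
has squared modulus at least `1 / N`, whence the factor `N`. -/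
theorem exists_small_combination [NeZero N] :
    ∃ (k : Fin N) (v : Fin N → ℂ), v k = 1 ∧ (∀ i, ‖v i‖ ≤ 1) ∧
      ∀ j, ‖∑ i, v i * H i j‖ ^ 2 ≤ N * lambdaMin H := by
  obtain ⟨x, hx, hxl⟩ := exists_sqNorm_conjTranspose_mulVec_eq H
  obtain ⟨k, -, hk⟩ := Finset.exists_max_image Finset.univ (fun i => ‖x i‖) ⟨0, Finset.mem_univ _⟩
  have hk1 : 1 ≤ N * ‖x k‖ ^ 2 := by
    rw [← hx, sqNorm]
    refine (Finset.sum_le_card_nsmul _ _ (‖x k‖ ^ 2) fun i hi => ?_).trans_eq (by simp)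
    have := hk i hi
    gcongr
  have hk0 : 0 < ‖x k‖ := by
    rcases (norm_nonneg (x k)).lt_or_eq with h | h
    · exact h
    · rw [← h] at hk1
      norm_num at hk1
  have hk0' : x k ≠ 0 := norm_pos_iff.1 hk0
  refine ⟨k, fun i => star (x i) / star (x k), div_self (star_ne_zero.2 hk0'), fun i => ?_,
    fun j => ?_⟩
  · rw [norm_div, norm_star, norm_star, div_le_one hk0]
    exact hk i (Finset.mem_univ i)
  · have e : ∑ i, star (x i) / star (x k) * H i j = star ((Hᴴ *ᵥ x) j) / star (x k) := by
      simp only [Matrix.mulVec, dotProduct, star_sum, Finset.sum_div, star_mul',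
        Matrix.conjTranspose_apply, star_star]
      exact Finset.sum_congr rfl fun i _ => by ring
    rw [e, norm_div, norm_star, norm_star, div_pow, div_le_iff₀ (by positivity)]
    have h1 := norm_sq_le_sqNorm (Hᴴ *ᵥ x) j
    rw [hxl] at h1
    have h2 : 0 ≤ lambdaMin H := le_trans (by positivity) h1
    nlinarith

theorem lambdaMin_nonneg [NeZero N] : 0 ≤ lambdaMin H := by
  obtain ⟨x, -, hx⟩ := exists_sqNorm_conjTranspose_mulVec_eq H
  exact hx ▸ sqNorm_nonneg _

theorem det_gram_ne_zero (h : 0 < lambdaMin H) : (H * Hᴴ).det ≠ 0 := by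
  intro h0
  obtain ⟨x, hx, hx0⟩ := Matrix.exists_mulVec_eq_zero_iff.2 h0
  have h1 := lambdaMin_mul_sqNorm_le H x
  have h2 : (sqNorm (Hᴴ *ᵥ x) : ℂ) = 0 := by
    rw [← star_dotProduct_self, ← star_dotProduct_gram_mulVec, hx0, dotProduct_zero]
  have h3 : sqNorm (Hᴴ *ᵥ x) = 0 := by exact_mod_cast h2
  have h4 : sqNorm x ≠ 0 := fun h => hx (sqNorm_eq_zero.1 h)
  have h5 : 0 < sqNorm x := lt_of_le_of_ne (sqNorm_nonneg x) h4.symm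
  have := mul_pos h h5
  linarith

section Solve

variable {H} {x : Fin N → ℂ} {k : Fin N}

theorem apply_eq_of_gram_mulVec_eq_single (hx : (H * Hᴴ) *ᵥ x = Pi.single k 1) :
    x k = (sqNorm (Hᴴ *ᵥ x) : ℂ) := by
  have h : star x ⬝ᵥ (H * Hᴴ) *ᵥ x = star (x k) := by simp [hx]
  rw [star_dotProduct_gram_mulVec, star_dotProduct_self] at h
  rw [← star_star (x k), ← h]
  exact Complex.conj_ofReal _

/-- Since `x k = ‖Hᴴ x‖² ≥ λ_min ‖x‖²` and `|x k|² ≤ ‖x‖²`, one gets `λ_min² ‖x‖⁴ ≤ ‖x‖²`. -/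
theorem sqNorm_le_of_gram_mulVec_eq_single (hx : (H * Hᴴ) *ᵥ x = Pi.single k 1)
    (hl : 0 < lambdaMin H) : sqNorm x ≤ 1 / lambdaMin H ^ 2 := by
  have h1 := lambdaMin_mul_sqNorm_le H x
  have h2 := norm_sq_le_sqNorm x k
  rw [apply_eq_of_gram_mulVec_eq_single hx, Complex.norm_real, Real.norm_eq_abs, sq_abs] at h2
  have h3 := sqNorm_nonneg x
  have h4 : (lambdaMin H * sqNorm x) ^ 2 ≤ sqNorm x := le_trans (by gcongr) h2
  rw [le_div_iff₀ (by positivity)]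
  rcases h3.lt_or_eq with h | h
  · by_contra! hc
    nlinarith
  · rw [← h]; simp

/-- Cauchy–Schwarz applied to `v k = ⟨Hᴴ v̄, Hᴴ x⟩`, with `‖Hᴴ x‖² = x k`. A near-null combination
thus makes the k-th diagonal entry of the inverse large wherever `v k` is not small. -/
theorem norm_sq_le_of_gram_mulVec_eq_single (hx : (H * Hᴴ) *ᵥ x = Pi.single k 1)
    {v : Fin N → ℂ} {r : ℝ} (hv : ∀ j, ‖∑ i, v i * H i j‖ ≤ r) :
    ‖v k‖ ^ 2 ≤ M * r ^ 2 * (x k).re := by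
  have h1 : star (star v) ⬝ᵥ (H * Hᴴ) *ᵥ x = v k := by simp [hx]
  rw [star_dotProduct_gram_mulVec] at h1
  rw [← h1, apply_eq_of_gram_mulVec_eq_single hx, Complex.ofReal_re]
  refine (norm_star_dotProduct_sq_le _ _).trans ?_
  refine mul_le_mul_of_nonneg_right ?_ (sqNorm_nonneg _)
  have e : Hᴴ *ᵥ star v = star (v ᵥ* H) := (Matrix.star_vecMul H v).symm
  rw [e, sqNorm_star, sqNorm]
  refine (Finset.sum_le_card_nsmul _ _ (r ^ 2) fun j _ => ?_).trans_eq (by simp)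
  exact pow_le_pow_left₀ (norm_nonneg _) (hv j) 2

end Solve

theorem lambdaMin_le_of_isNearlySingular {a B r : ℝ} (h : IsNearlySingular a B r H) :
    lambdaMin H ≤ M * r ^ 2 := by
  obtain ⟨-, -, v, ⟨k, hk⟩, -, hv⟩ := h
  have : NeZero N := ⟨fun h => by subst h; exact k.elim0⟩
  have h1 := lambdaMin_mul_sqNorm_le H (star v)
  have h2 := norm_sq_le_sqNorm (star v) k
  have e : Hᴴ *ᵥ star v = star (v ᵥ* H) := (Matrix.star_vecMul H v).symm
  rw [e, sqNorm_star (v ᵥ* H)] at h1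
  have h3 : sqNorm (v ᵥ* H) ≤ M * r ^ 2 := by
    rw [sqNorm]
    refine (Finset.sum_le_card_nsmul _ _ (r ^ 2) fun j _ => ?_).trans_eq (by simp)
    exact pow_le_pow_left₀ (norm_nonneg _) (hv j) 2
  simp [hk] at h2
  have h4 := lambdaMin_nonneg H
  nlinarith

end PrecodedMIMO

/-! ### Noise gains of the two precoders -/

namespace PrecodedMIMO

/-- The squared Frobenius norm. -/
noncomputable def frobSq {m n : Type*} [Fintype m] [Fintype n] (T : Matrix m n ℂ) : ℝ :=
  ∑ i, ∑ j, ‖T i j‖ ^ 2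

section FrobSq

variable {l m n : Type*} [Fintype l] [Fintype m] [Fintype n]

theorem frobSq_nonneg (T : Matrix m n ℂ) : 0 ≤ frobSq T := by unfold frobSq; positivity

theorem norm_sq_le_frobSq (T : Matrix m n ℂ) (i : m) (j : n) : ‖T i j‖ ^ 2 ≤ frobSq T :=
  (norm_sq_le_sqNorm (T i) j).trans
    (Finset.single_le_sum (f := fun i => sqNorm (T i)) (fun _ _ => sqNorm_nonneg _)
      (Finset.mem_univ i))

theorem frobSq_eq_zero {T : Matrix m n ℂ} (h : frobSq T = 0) : T = 0 := by
  ext i j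
  have h1 := norm_sq_le_frobSq T i j
  rw [h] at h1
  simpa using (sq_nonpos_iff _).1 h1

theorem re_trace_mul_conjTranspose (T : Matrix m n ℂ) : (T * Tᴴ).trace.re = frobSq T := by
  simp only [Matrix.trace, Matrix.diag, Matrix.mul_apply, Matrix.conjTranspose_apply, frobSq,
    Complex.re_sum]
  refine Finset.sum_congr rfl fun i _ => Finset.sum_congr rfl fun j _ => ?_
  have := Complex.mul_conj' (T i j)
  rw [Complex.star_def, this]
  exact_mod_cast Complex.ofReal_re _

theorem frobSq_conjTranspose (T : Matrix m n ℂ) : frobSq Tᴴ = frobSq T := by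
  simp only [frobSq, Matrix.conjTranspose_apply, norm_star]
  exact Finset.sum_comm

open scoped Matrix.Norms.Frobenius in
theorem frobSq_eq_norm_sq (T : Matrix m n ℂ) : frobSq T = ‖T‖ ^ 2 := by
  rw [Matrix.frobenius_norm_def, ← Real.sqrt_eq_rpow, Real.sq_sqrt]
  · simp [frobSq]
  · positivity

open scoped Matrix.Norms.Frobenius in
theorem frobSq_mul_le (A : Matrix l m ℂ) (B : Matrix m n ℂ) :
    frobSq (A * B) ≤ frobSq A * frobSq B := by
  simp only [frobSq_eq_norm_sq, ← mul_pow]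
  gcongr
  exact Matrix.frobenius_norm_mul A B

theorem frobSq_le_of_forall_le {T : Matrix m n ℂ} {b : ℝ} (h : ∀ i j, ‖T i j‖ ≤ b) :
    frobSq T ≤ Fintype.card m * (Fintype.card n * b ^ 2) := by
  unfold frobSq
  refine (Finset.sum_le_card_nsmul _ _ (Fintype.card n * b ^ 2) fun i _ => ?_).trans_eq (by simp)
  refine (Finset.sum_le_card_nsmul _ _ (b ^ 2) fun j _ => ?_).trans_eq (by simp)
  exact pow_le_pow_left₀ (norm_nonneg _) (h i j) 2

end FrobSq

variable {N M : ℕ}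

/-- The factor by which the power of the noise in stream `k` is amplified when the channel `H`,
precoded by the normalization of `T`, is zero-forcing equalized. -/
noncomputable def noiseGain (H : Matrix (Fin N) (Fin M) ℂ) (T : Matrix (Fin M) (Fin N) ℂ)
    (k : Fin N) : ℝ :=
  frobSq T * sqNorm ((H * T)⁻¹ k)

theorem noiseGain_pos {H : Matrix (Fin N) (Fin M) ℂ} {T : Matrix (Fin M) (Fin N) ℂ}
    (h : (H * T).det ≠ 0) (k : Fin N) : 0 < noiseGain H T k := by
  refine mul_pos (lt_of_le_of_ne (frobSq_nonneg T) fun h0 => ?_)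
    (lt_of_le_of_ne (sqNorm_nonneg _) fun h0 => ?_)
  · have : Nonempty (Fin N) := ⟨k⟩
    rw [frobSq_eq_zero h0.symm, Matrix.mul_zero, Matrix.det_zero] at h
    exact h rfl
  · have h1 : (H * T)⁻¹ k = 0 := sqNorm_eq_zero.1 h0.symm
    have h2 : ((H * T)⁻¹ * (H * T)) k k = 1 := by
      rw [Matrix.nonsing_inv_mul _ (isUnit_iff_ne_zero.2 h), Matrix.one_apply_eq]
    rw [Matrix.mul_apply] at h2
    simp [h1] at h2

theorem re_mul_conjTranspose_apply_self (W : Matrix (Fin N) (Fin N) ℂ) (k : Fin N) :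
    ((W * Wᴴ) k k).re = sqNorm (W k) := by
  simp only [Matrix.mul_apply, Matrix.conjTranspose_apply, sqNorm, Complex.re_sum]
  refine Finset.sum_congr rfl fun j _ => ?_
  rw [Complex.star_def, Complex.mul_conj']
  exact_mod_cast Complex.ofReal_re _

/-- If `H T` is invertible, the equalizer is the inverse of the composite channel and `|β|⁻² =
‖T‖²`. If it is singular, the inverses default to 0 and both sides are 0, since division by 0 gives
0. -/
theorem sinr_normalizedPrecoder (H : Matrix (Fin N) (Fin M) ℂ) (T : Matrix (Fin M) (Fin N) ℂ)
    (ρ : ℝ) (k : Fin N) :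
    sinr ρ (H * normalizedPrecoder T) (zfEqualizer (H * normalizedPrecoder T)) k =
      ρ / N / noiseGain H T k := by
  set β : ℂ := (((Real.sqrt (frobSq T))⁻¹ : ℝ) : ℂ) with hβ
  have hG : H * normalizedPrecoder T = β • (H * T) := by
    rw [normalizedPrecoder, re_trace_mul_conjTranspose, Matrix.mul_smul]
  have : Nonempty (Fin N) := ⟨k⟩
  rw [hG, sinr]
  by_cases h : (H * T).det = 0
  · have h1 : (β • (H * T)).det = 0 := by rw [Matrix.det_smul, h, mul_zero]
    have h2 : zfEqualizer (β • (H * T)) = 0 := by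
      rw [zfEqualizer, Matrix.nonsing_inv_apply_not_isUnit, Matrix.zero_mul]
      rw [Matrix.det_mul, h1, mul_zero]
      exact not_isUnit_zero
    have h3 : (H * T)⁻¹ = 0 := Matrix.nonsing_inv_apply_not_isUnit _ (by simp [h])
    have h4 : sqNorm ((0 : Matrix (Fin N) (Fin N) ℂ) k) = 0 := by simp [sqNorm]
    rw [noiseGain, h2, h3, h4]
    simp
  · have hη : 0 < frobSq T :=
      pos_of_mul_pos_left (noiseGain_pos h k) (sqNorm_nonneg _)
    have hβ0 : β ≠ 0 := by
      rw [hβ]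
      exact_mod_cast (inv_pos.2 (Real.sqrt_pos.2 hη)).ne'
    have hG0 : IsUnit (β • (H * T)).det := by
      rw [Matrix.det_smul]
      exact isUnit_iff_ne_zero.2 (mul_ne_zero (pow_ne_zero _ hβ0) h)
    have hW : zfEqualizer (β • (H * T)) = (β • (H * T))⁻¹ := by
      rw [zfEqualizer, Matrix.mul_inv_rev, Matrix.mul_assoc, Matrix.nonsing_inv_mul,
        Matrix.mul_one]
      rw [Matrix.det_conjTranspose]
      exact hG0.star
    have hinv : (β • (H * T))⁻¹ = β⁻¹ • (H * T)⁻¹ := by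
      refine Matrix.inv_eq_left_inv ?_
      rw [Matrix.smul_mul, Matrix.mul_smul, Matrix.nonsing_inv_mul _ (isUnit_iff_ne_zero.2 h),
        smul_smul, inv_mul_cancel₀ hβ0, one_smul]
    have hβn : ‖β⁻¹‖ ^ 2 = frobSq T := by
      rw [hβ, norm_inv, Complex.norm_real, Real.norm_eq_abs, abs_inv, inv_inv, sq_abs,
        Real.sq_sqrt hη.le]
    have hWn : sqNorm ((β⁻¹ • (H * T)⁻¹) k) = noiseGain H T k := by
      rw [noiseGain, ← hβn]
      simp only [sqNorm, Matrix.smul_apply, smul_eq_mul, norm_mul, mul_pow, Finset.mul_sum]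
    rw [re_mul_conjTranspose_apply_self, hW, Matrix.nonsing_inv_mul _ hG0, hinv, hWn]
    have h0 : ∑ i ∈ Finset.univ.erase k, ‖(1 : Matrix (Fin N) (Fin N) ℂ) k i‖ ^ 2 = 0 := by
      refine Finset.sum_eq_zero fun i hi => ?_
      rw [Matrix.one_apply_ne (Finset.ne_of_mem_erase hi).symm]
      simp
    rw [h0]
    simp

section Gram

variable {H : Matrix (Fin N) (Fin M) ℂ}

theorem gram_mulVec_inv_col (h : (H * Hᴴ).det ≠ 0) (k : Fin N) :
    (H * Hᴴ) *ᵥ ((H * Hᴴ)⁻¹ *ᵥ Pi.single k 1) = Pi.single k 1 := by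
  rw [Matrix.mulVec_mulVec, Matrix.mul_nonsing_inv _ (isUnit_iff_ne_zero.2 h), Matrix.one_mulVec]

theorem gram_inv_row (k : Fin N) :
    (H * Hᴴ)⁻¹ k = star ((H * Hᴴ)⁻¹ *ᵥ Pi.single k 1) := by
  have h := (Matrix.isHermitian_mul_conjTranspose_self H).inv
  ext i
  have := h.apply k i
  simp [← this]

theorem sqNorm_gram_inv_le (hl : 0 < lambdaMin H) (k : Fin N) :
    sqNorm ((H * Hᴴ)⁻¹ k) ≤ 1 / lambdaMin H ^ 2 := by
  rw [gram_inv_row, sqNorm_star]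
  exact sqNorm_le_of_gram_mulVec_eq_single (gram_mulVec_inv_col (det_gram_ne_zero H hl) k) hl

theorem IsNearlySingular.le_re_gram_inv_apply (h : (H * Hᴴ).det ≠ 0) {a B r : ℝ} (ha : 0 < a)
    (hH : IsNearlySingular a B r H) (k : Fin N) :
    a ^ 2 ≤ M * r ^ 2 * ((H * Hᴴ)⁻¹ k k).re := by
  obtain ⟨-, -, v, -, hva, hv⟩ := hH
  have h1 := norm_sq_le_of_gram_mulVec_eq_single (gram_mulVec_inv_col h k) hv
  rw [gram_inv_row, Pi.star_apply, Complex.star_def, Complex.conj_re]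
  refine le_trans ?_ h1
  have := hva k
  gcongr

theorem lambdaMin_le_frobSq [NeZero N] : lambdaMin H ≤ frobSq H := by
  have h := lambdaMin_mul_sqNorm_le H (Pi.single 0 1)
  have h1 : sqNorm (Pi.single (0 : Fin N) (1 : ℂ)) = 1 := by
    simp [sqNorm, Pi.single_apply, apply_ite]
  rw [h1, mul_one] at h
  refine h.trans ?_
  have e : Hᴴ *ᵥ Pi.single 0 1 = star (H 0) := by
    ext j; simp
  rw [e, sqNorm_star]
  exact Finset.single_le_sum (f := fun i => sqNorm (H i)) (fun _ _ => sqNorm_nonneg _)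
    (Finset.mem_univ 0)

end Gram

/-- An upper bound for the noise gain of a precoder in terms of the smallest eigenvalue, valid for
all channels, and a lower bound, valid for nearly singular channels. -/
structure HasNoiseGainBounds (T : Matrix (Fin N) (Fin M) ℂ → Matrix (Fin M) (Fin N) ℂ) :
    Prop where
  upper : ∃ C > 0, ∀ H k, 0 < lambdaMin H → 0 < noiseGain H (T H) k ∧
    noiseGain H (T H) k ≤ C * (1 + frobSq H) ^ 2 / lambdaMin H ^ 2
  lower : ∀ a > 0, ∀ B > 0, ∃ c > 0, ∀ r > 0, ∀ H k, IsNearlySingular a B r H →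
    noiseGain H (T H) k = 0 ∨ c / r ^ 4 ≤ noiseGain H (T H) k

theorem noiseGain_eq_zero {H : Matrix (Fin N) (Fin M) ℂ} {T : Matrix (Fin M) (Fin N) ℂ}
    (h : (H * T).det = 0) (k : Fin N) : noiseGain H T k = 0 := by
  have h3 : (H * T)⁻¹ = 0 := Matrix.nonsing_inv_apply_not_isUnit _ (by simp [h])
  rw [noiseGain, h3]
  simp [sqNorm]

theorem le_mul_sqNorm_of_le_re_diag {A : Matrix (Fin N) (Fin N) ℂ} {k : Fin N} {t b r : ℝ}
    (ht : 0 ≤ t) (hM : 0 < M) (hr : 0 < r) (hb : 0 < b) {η : ℝ} (hη : b ≤ η)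
    (hA : t ≤ M * r ^ 2 * (A k k).re) :
    b * (t / M) ^ 2 / r ^ 4 ≤ η * sqNorm (A k) := by
  have h1 : t / M / r ^ 2 ≤ (A k k).re := by
    rw [div_div, div_le_iff₀ (by positivity)]
    linarith
  have h2 : (t / M / r ^ 2) ^ 2 ≤ sqNorm (A k) := by
    refine le_trans ?_ (norm_sq_le_sqNorm (A k) k)
    gcongr
    exact h1.trans ((le_abs_self _).trans (Complex.abs_re_le_norm _))
  calc b * (t / M) ^ 2 / r ^ 4 = b * (t / M / r ^ 2) ^ 2 := by ring
    _ ≤ _ := by gcongr; exact hb.le.trans hη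

theorem IsNearlySingular.sq_le_frobSq {H : Matrix (Fin N) (Fin M) ℂ} {a B r : ℝ} (ha : 0 < a)
    (h : IsNearlySingular a B r H) : 0 < M ∧ a ^ 2 ≤ frobSq H := by
  obtain ⟨-, ⟨i, j, hij⟩, -⟩ := h
  refine ⟨j.pos, le_trans ?_ (norm_sq_le_frobSq H i j)⟩
  gcongr

theorem hasNoiseGainBounds_matchedFilter :
    HasNoiseGainBounds fun H : Matrix (Fin N) (Fin M) ℂ => Hᴴ where
  upper := by
    refine ⟨1, one_pos, fun H k hl => ⟨noiseGain_pos (det_gram_ne_zero H hl) k, ?_⟩⟩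
    have h1 := sqNorm_gram_inv_le hl k
    have h2 := frobSq_nonneg H
    rw [noiseGain, frobSq_conjTranspose]
    calc frobSq H * sqNorm ((H * Hᴴ)⁻¹ k) ≤ (1 + frobSq H) ^ 2 * (1 / lambdaMin H ^ 2) := by
          gcongr
          · exact sqNorm_nonneg _
          · nlinarith
      _ = _ := by ring
  lower := by
    intro a ha B hB
    rcases Nat.eq_zero_or_pos M with rfl | hM
    · exact ⟨1, one_pos, fun r hr H k h => absurd (h.sq_le_frobSq ha).1 (lt_irrefl 0)⟩
    refine ⟨a ^ 2 * (a ^ 2 / M) ^ 2, by positivity, fun r hr H k h => ?_⟩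
    by_cases hdet : (H * Hᴴ).det = 0
    · exact Or.inl (noiseGain_eq_zero hdet k)
    · refine Or.inr (le_mul_sqNorm_of_le_re_diag (sq_nonneg a) hM hr (by positivity) ?_
        (h.le_re_gram_inv_apply hdet ha k))
      rw [frobSq_conjTranspose]
      exact (h.sq_le_frobSq ha).2

/-- The regularized Gram matrix `H Hᴴ + c I`. -/
noncomputable def regGram (c : ℝ) (H : Matrix (Fin N) (Fin M) ℂ) : Matrix (Fin N) (Fin N) ℂ :=
  H * Hᴴ + (c : ℂ) • (1 : Matrix (Fin N) (Fin N) ℂ)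

section RegGram

variable {c : ℝ} {H : Matrix (Fin N) (Fin M) ℂ}

theorem star_dotProduct_regGram_mulVec (x : Fin N → ℂ) :
    star x ⬝ᵥ regGram c H *ᵥ x = ((sqNorm (Hᴴ *ᵥ x) + c * sqNorm x : ℝ) : ℂ) := by
  rw [regGram, Matrix.add_mulVec, dotProduct_add, star_dotProduct_gram_mulVec,
    star_dotProduct_self, Matrix.smul_mulVec, Matrix.one_mulVec, dotProduct_smul,
    star_dotProduct_self]
  push_cast
  rfl

theorem det_regGram_ne_zero (hc : 0 < c) : (regGram c H).det ≠ 0 := by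
  intro h0
  obtain ⟨x, hx, hx0⟩ := Matrix.exists_mulVec_eq_zero_iff.2 h0
  have h := star_dotProduct_regGram_mulVec (c := c) (H := H) x
  rw [hx0, dotProduct_zero] at h
  have h1 : (0 : ℝ) = sqNorm (Hᴴ *ᵥ x) + c * sqNorm x := by exact_mod_cast h
  have h2 := sqNorm_nonneg (Hᴴ *ᵥ x)
  have h3 : 0 < sqNorm x :=
    lt_of_le_of_ne (sqNorm_nonneg x) fun h => hx (sqNorm_eq_zero.1 h.symm)
  have := mul_pos hc h3
  linarith

/-- For a column `x` of the regularized inverse put `u = ‖Hᴴ x‖²` and `s = ‖x‖²`. Then `|x k| = u +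
c s`, so `(u + c s)² ≤ s`, which forces `u c ≤ 1` independently of `H`. -/
theorem frobSq_regularizedZeroForcing_le (hc : 0 < c) :
    frobSq (Hᴴ * (regGram c H)⁻¹) ≤ N / c := by
  rw [← frobSq_conjTranspose, frobSq]
  refine (Finset.sum_le_card_nsmul _ _ (1 / c) fun k _ => ?_).trans_eq (by simp; ring)
  set x := (regGram c H)⁻¹ *ᵥ Pi.single k 1 with hx
  have hsolve : regGram c H *ᵥ x = Pi.single k 1 := by
    rw [hx, Matrix.mulVec_mulVec, Matrix.mul_nonsing_inv _
      (isUnit_iff_ne_zero.2 (det_regGram_ne_zero hc)), Matrix.one_mulVec]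
  have h := star_dotProduct_regGram_mulVec (c := c) (H := H) x
  have e : star x ⬝ᵥ Pi.single k 1 = star (x k) := by simp
  rw [hsolve, e] at h
  have h1 := congrArg norm h
  rw [norm_star, Complex.norm_real, Real.norm_eq_abs] at h1
  have h2 := norm_sq_le_sqNorm x k
  rw [h1, sq_abs] at h2
  have h3 := sqNorm_nonneg x
  have h4 := sqNorm_nonneg (Hᴴ *ᵥ x)
  have e2 : ∑ j, ‖(Hᴴ * (regGram c H)⁻¹)ᴴ k j‖ ^ 2 = sqNorm (Hᴴ *ᵥ x) := by
    rw [hx, Matrix.mulVec_mulVec, sqNorm]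
    simp
  rw [e2, le_div_iff₀ hc]
  set u := sqNorm (Hᴴ *ᵥ x)
  set s := sqNorm x
  have h5 : u ^ 2 + 2 * (u * c) * s ≤ s := by nlinarith [sq_nonneg (c * s)]
  by_contra! h6
  have h7 : s ≤ u * c * s := le_mul_of_one_le_left h3 h6.le
  have h8 : 0 < u := pos_of_mul_pos_left (one_pos.trans h6) hc.le
  nlinarith [sq_pos_of_pos h8]

theorem mul_regularizedZeroForcing_inv (hc : 0 < c) (h : (H * Hᴴ).det ≠ 0) :
    (H * (Hᴴ * (regGram c H)⁻¹))⁻¹ = 1 + (c : ℂ) • (H * Hᴴ)⁻¹ := by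
  rw [← Matrix.mul_assoc, Matrix.mul_inv_rev, Matrix.nonsing_inv_nonsing_inv _
    (isUnit_iff_ne_zero.2 (det_regGram_ne_zero hc)), regGram, Matrix.add_mul,
    Matrix.mul_nonsing_inv _ (isUnit_iff_ne_zero.2 h), Matrix.smul_mul, Matrix.one_mul]

theorem det_mul_regularizedZeroForcing :
    (H * (Hᴴ * (regGram c H)⁻¹)).det = (H * Hᴴ).det * (regGram c H)⁻¹.det := by
  rw [← Matrix.mul_assoc, Matrix.det_mul]

theorem frobSq_regGram_le {B : ℝ} (hB : ∀ i j, ‖H i j‖ ≤ B) (hc : 0 < c) :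
    frobSq (regGram c H) ≤ N * (N * (M * B ^ 2 + c) ^ 2) := by
  refine (frobSq_le_of_forall_le (b := M * B ^ 2 + c) fun i j => ?_).trans_eq (by simp)
  refine (norm_add_le _ _).trans (add_le_add ?_ ?_)
  · rw [Matrix.mul_apply]
    refine (norm_sum_le _ _).trans
      ((Finset.sum_le_card_nsmul _ _ (B ^ 2) fun l _ => ?_).trans_eq (by simp))
    rw [norm_mul, Matrix.conjTranspose_apply, norm_star, sq]
    exact mul_le_mul (hB _ _) (hB _ _) (norm_nonneg _) ((norm_nonneg _).trans (hB i l))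
  · rw [Matrix.smul_apply, Matrix.one_apply, norm_smul, Complex.norm_real, Real.norm_eq_abs,
      abs_of_pos hc]
    split_ifs <;> simp [hc.le]

end RegGram

theorem hasNoiseGainBounds_regularizedZeroForcing {c : ℝ} (hc : 0 < c) :
    HasNoiseGainBounds fun H : Matrix (Fin N) (Fin M) ℂ => Hᴴ * (regGram c H)⁻¹ where
  upper := by
    refine ⟨N / c * (2 * (1 + c ^ 2)) + 1, by positivity, fun H k hl => ?_⟩
    have : NeZero N := ⟨fun h => by subst h; exact k.elim0⟩
    have hdet := det_gram_ne_zero H hl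
    refine ⟨noiseGain_pos ?_ k, ?_⟩
    · rw [det_mul_regularizedZeroForcing]
      refine mul_ne_zero hdet ?_
      rw [Matrix.det_nonsing_inv, Ring.inverse_eq_inv']
      exact inv_ne_zero (det_regGram_ne_zero hc)
    have h1 := sqNorm_gram_inv_le hl k
    have h2 := frobSq_nonneg H
    have h3 : sqNorm ((1 + (c : ℂ) • (H * Hᴴ)⁻¹) k) ≤ 2 * (1 + c ^ 2 * sqNorm ((H * Hᴴ)⁻¹ k)) := by
      have e1 : sqNorm ((1 : Matrix (Fin N) (Fin N) ℂ) k) = 1 := by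
        simp [sqNorm, Matrix.one_apply, apply_ite]
      rw [← e1]
      simp only [sqNorm, Finset.mul_sum, ← Finset.sum_add_distrib]
      refine Finset.sum_le_sum fun i _ => ?_
      rw [Matrix.add_apply, Matrix.smul_apply, smul_eq_mul]
      set u := (1 : Matrix (Fin N) (Fin N) ℂ) k i
      set z := (H * Hᴴ)⁻¹ k i
      have h4 : ‖u + c * z‖ ≤ ‖u‖ + c * ‖z‖ := by
        refine (norm_add_le _ _).trans_eq ?_
        rw [norm_mul, Complex.norm_real, Real.norm_eq_abs, abs_of_pos hc]
      calc ‖u + c * z‖ ^ 2 ≤ (‖u‖ + c * ‖z‖) ^ 2 := by gcongr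
        _ ≤ _ := by nlinarith [sq_nonneg (‖u‖ - c * ‖z‖)]
    -- Lets the term coming from the identity in `1 + c (H Hᴴ)⁻¹` be absorbed into the main one.
    have h5 : 1 ≤ (1 + frobSq H) ^ 2 / lambdaMin H ^ 2 := by
      rw [← div_pow]
      refine one_le_pow₀ ((one_le_div hl).2 ?_)
      linarith [lambdaMin_le_frobSq (H := H)]
    have h6 : 1 / lambdaMin H ^ 2 ≤ (1 + frobSq H) ^ 2 / lambdaMin H ^ 2 := by
      gcongr
      nlinarith
    rw [noiseGain, mul_regularizedZeroForcing_inv hc hdet, mul_div_assoc]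
    set q := (1 + frobSq H) ^ 2 / lambdaMin H ^ 2
    calc _ ≤ N / c * (2 * (q + c ^ 2 * q)) := by
          gcongr
          · exact sqNorm_nonneg _
          · exact frobSq_regularizedZeroForcing_le hc
          · refine h3.trans ?_
            gcongr
            exact h1.trans h6
      _ = N / c * (2 * (1 + c ^ 2)) * q := by ring
      _ ≤ _ := by
          gcongr
          linarith
  lower := by
    intro a ha B hB
    rcases Nat.eq_zero_or_pos N with rfl | hN
    · exact ⟨1, one_pos, fun r hr H k h => k.elim0⟩
    rcases Nat.eq_zero_or_pos M with rfl | hM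
    · exact ⟨1, one_pos, fun r hr H k h => absurd (h.sq_le_frobSq ha).1 (lt_irrefl 0)⟩
    set D : ℝ := N * (N * (M * B ^ 2 + c) ^ 2) with hD
    have hD0 : 0 < D := by positivity
    refine ⟨a ^ 2 / D * (c * a ^ 2 / M) ^ 2, by positivity, fun r hr H k h => ?_⟩
    by_cases hdet : (H * Hᴴ).det = 0
    · refine Or.inl (noiseGain_eq_zero ?_ k)
      rw [det_mul_regularizedZeroForcing, hdet, zero_mul]
    · refine Or.inr ?_
      -- Submultiplicativity applied to `Hᴴ = T (H Hᴴ + c I)`, whose last factor is bounded because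
      -- the entries of `H` are.
      have hη : a ^ 2 / D ≤ frobSq (Hᴴ * (regGram c H)⁻¹) := by
        rw [div_le_iff₀ hD0]
        calc a ^ 2 ≤ frobSq Hᴴ := by
              rw [frobSq_conjTranspose]
              exact (h.sq_le_frobSq ha).2
          _ = frobSq (Hᴴ * (regGram c H)⁻¹ * regGram c H) := by
              rw [Matrix.mul_assoc, Matrix.nonsing_inv_mul _
                (isUnit_iff_ne_zero.2 (det_regGram_ne_zero hc)), Matrix.mul_one]
          _ ≤ _ := frobSq_mul_le _ _
          _ ≤ _ := by
              gcongr
              · exact frobSq_nonneg _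
              · exact frobSq_regGram_le h.1 hc
      have h1 := h.le_re_gram_inv_apply hdet ha k
      rw [noiseGain, mul_regularizedZeroForcing_inv hc hdet]
      refine le_mul_sqNorm_of_le_re_diag (by positivity) hM hr (by positivity) hη ?_
      have h2 : ((1 + (c : ℂ) • (H * Hᴴ)⁻¹) k k).re = 1 + c * ((H * Hᴴ)⁻¹ k k).re := by
        simp
      rw [h2]
      have h3 : (0 : ℝ) ≤ M * r ^ 2 := by positivity
      nlinarith

end PrecodedMIMO

/-! ### SNR exponents of the smallest eigenvalue and of the outage -/

namespace PrecodedMIMO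

variable {Ω : Type*} [MeasurableSpace Ω] {P : Measure Ω} [IsProbabilityMeasure P] {N M : ℕ}
  {H : Ω → Matrix (Fin N) (Fin M) ℂ}

theorem IsRayleighChannel.exists_measure_lambdaMin_le (hN : 2 ≤ N) (hNM : N ≤ M)
    (hH : IsRayleighChannel P H) {K ε : ℝ} (hK : 0 < K) (hε : 0 < ε) :
    ∃ C > 0, ∀ᶠ ρ : ℝ in atTop,
      P {ω | lambdaMin (H ω) ≤ K * (1 + frobSq (H ω)) * ρ ^ (-(1 / 2) : ℝ)} ≤
        ENNReal.ofReal (C * ρ ^ (-(((M : ℝ) - N + 1) / 2) + ε)) := by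
  have : NeZero N := ⟨by omega⟩
  have hM : 0 < M := by omega
  set d : ℝ := ((M : ℝ) - N + 1) / 2 with hd
  -- Makes `b ^ (2 M) = ρ ^ ε`, exactly the allowed loss; a moment of order above `d / δ` makes the
  -- tail beyond `b` negligible.
  set δ : ℝ := ε / (2 * M) with hδ
  have hδ0 : 0 < δ := by positivity
  obtain ⟨p, hp⟩ := exists_nat_ge (d / δ)
  obtain ⟨C₁, hC₁, htail⟩ := hH.measure_exists_entry_le (p + 1) (by omega)
  obtain ⟨C₂, hC₂, hsmall⟩ := hH.exists_measure_small_combination_le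
  set L : ℝ := N * (K * (1 + N * M)) with hL
  have hL0 : 0 < L := by positivity
  refine ⟨C₁ + C₂ * L ^ (M + 1 - N), by positivity, ?_⟩
  filter_upwards [eventually_ge_atTop (1 : ℝ), eventually_ge_atTop (L ^ 2)] with ρ hρ hρL
  have hρ0 : 0 < ρ := by linarith
  set b : ℝ := ρ ^ δ with hb
  have hb1 : 1 ≤ b := Real.one_le_rpow hρ hδ0.le
  set t : ℝ := ρ ^ (-(1 / 2) : ℝ) with ht
  have ht0 : 0 < t := by positivity
  have htL : L * t ≤ 1 := by
    have h1 : L ≤ ρ ^ (1 / 2 : ℝ) := by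
      rw [← Real.sqrt_eq_rpow]
      exact Real.le_sqrt_of_sq_le hρL
    have h2 : ρ ^ (1 / 2 : ℝ) * t = 1 := by
      rw [ht, ← Real.rpow_add hρ0]
      norm_num
    rw [← h2]
    gcongr
  set r : ℝ := √(L * t) * b with hr
  have hr0 : 0 < r := by positivity
  have hr2 : r ^ 2 = L * t * b ^ 2 := by
    rw [hr, mul_pow, Real.sq_sqrt (by positivity)]
  have hrb : r ≤ b := by
    have : √(L * t) ≤ 1 := Real.sqrt_le_one.2 htL
    rw [hr]
    exact mul_le_of_le_one_left (by positivity) this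
  have hsub : {ω | lambdaMin (H ω) ≤ K * (1 + frobSq (H ω)) * t} ⊆
      {ω | ∃ i j, b ≤ ‖H ω i j‖} ∪ {ω | (∀ i j, ‖H ω i j‖ ≤ b) ∧ ∃ k, ∃ v : Fin N → ℂ, v k = 1 ∧
        (∀ i, ‖v i‖ ≤ 1) ∧ ∀ j, ‖∑ i, v i * H ω i j‖ ≤ r} := by
    intro ω hω
    by_cases h : ∃ i j, b ≤ ‖H ω i j‖
    · exact Or.inl h
    · push Not at h
      have h' : ∀ i j, ‖H ω i j‖ ≤ b := fun i j => (h i j).le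
      obtain ⟨k, v, hk, hv, hvs⟩ := exists_small_combination (H ω)
      refine Or.inr ⟨h', k, v, hk, hv, fun j => ?_⟩
      refine le_of_sq_le_sq ((hvs j).trans ?_) hr0.le
      have h1 : frobSq (H ω) ≤ N * (M * b ^ 2) := by
        simpa using frobSq_le_of_forall_le h'
      have h2 : 1 + frobSq (H ω) ≤ (1 + N * M) * b ^ 2 := by nlinarith
      have h3 : lambdaMin (H ω) ≤ K * (1 + frobSq (H ω)) * t := hω
      calc N * lambdaMin (H ω) ≤ N * (K * ((1 + N * M) * b ^ 2) * t) := by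
            gcongr
            exact h3.trans (by gcongr)
        _ = r ^ 2 := by rw [hr2, hL]; ring
  refine (measure_mono hsub).trans ((measure_union_le _ _).trans ?_)
  refine (add_le_add (htail b (by positivity)) (hsmall r b hr0 hrb)).trans ?_
  rw [← ENNReal.ofReal_add (by positivity) (by positivity)]
  refine ENNReal.ofReal_le_ofReal ?_
  rw [add_mul]
  refine add_le_add ?_ ?_
  · gcongr
    rw [hb, ← Real.rpow_natCast, ← Real.rpow_mul hρ0.le, ← Real.rpow_neg hρ0.le]
    refine Real.rpow_le_rpow_of_exponent_le hρ ?_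
    rw [div_le_iff₀ hδ0] at hp
    push_cast
    nlinarith
  · obtain ⟨m, rfl⟩ : ∃ m, M = N - 1 + m := ⟨M - (N - 1), by omega⟩
    have e1 : (b / r) ^ 2 * r ^ 2 = b ^ 2 := by field_simp
    have e2 : N - 1 + m + 1 - N = m := by omega
    have e3 : ((b / r) ^ 2) ^ (N - 1) * (r ^ 2) ^ (N - 1 + m) =
        L ^ m * ((b ^ 2) ^ (N - 1 + m) * t ^ m) := by
      rw [pow_add, ← mul_assoc, ← mul_pow, e1, hr2, mul_pow, mul_pow, pow_add]
      ring
    have e4 : (b ^ 2) ^ (N - 1 + m) * t ^ m = ρ ^ (-d + ε) := by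
      rw [hb, ht, ← pow_mul, ← Real.rpow_natCast, ← Real.rpow_natCast (n := m),
        ← Real.rpow_mul hρ0.le, ← Real.rpow_mul hρ0.le, ← Real.rpow_add hρ0]
      congr 1
      have h5 : ((N - 1 + m : ℕ) : ℝ) ≠ 0 := by exact_mod_cast hM.ne'
      have h6 : d = m / 2 := by
        rw [hd]
        push_cast [Nat.cast_sub (show 1 ≤ N by omega)]
        ring
      rw [h6, hδ]
      push_cast at h5 ⊢
      field_simp
      ring
    rw [mul_assoc, e3, e2, e4, mul_assoc]

theorem IsRayleighChannel.exists_le_measure_isNearlySingular_rpow (hN : 2 ≤ N) (hNM : N ≤ M)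
    (hH : IsRayleighChannel P H) :
    ∃ a > (0 : ℝ), ∃ B > (0 : ℝ), ∀ s > (0 : ℝ), s ≤ 1 → ∃ c > (0 : ℝ), ∀ ρ ≥ (1 : ℝ),
      c * ρ ^ (-(((M : ℝ) - N + 1) / 2)) ≤
        P.real {ω | IsNearlySingular a B (s * ρ ^ (-(1 / 4) : ℝ)) (H ω)} := by
  obtain ⟨c, hc, a, ha, B, hB, h⟩ := hH.exists_le_measure_isNearlySingular hN hNM
  refine ⟨a, ha, B, hB, fun s hs hs1 => ⟨c * (s ^ 2) ^ (M + 1 - N), by positivity,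
    fun ρ hρ => ?_⟩⟩
  have hρ0 : 0 < ρ := by linarith
  have h1 : ρ ^ (-(1 / 4) : ℝ) ≤ 1 := Real.rpow_le_one_of_one_le_of_nonpos hρ (by norm_num)
  have h2 := h (s * ρ ^ (-(1 / 4) : ℝ)) (by positivity) (mul_le_one₀ hs1 (by positivity) h1)
  rw [measureReal_def]
  refine (ENNReal.ofReal_le_iff_le_toReal (measure_ne_top _ _)).1 (le_trans (le_of_eq ?_) h2)
  congr 1
  rw [mul_assoc, mul_pow s, mul_pow (s ^ 2)]
  congr 2
  rw [← pow_mul, ← Real.rpow_natCast, ← Real.rpow_mul hρ0.le]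
  congr 1
  push_cast [Nat.cast_sub (show N ≤ M + 1 by omega)]
  ring

theorem IsRayleighChannel.hasExponent_lambdaMin (hN : 2 ≤ N) (hNM : N ≤ M)
    (hH : IsRayleighChannel P H) :
    HasExponent (fun ρ => P.real {ω | lambdaMin (H ω) ≤ ρ ^ (-(1 / 2) : ℝ)})
      (-(((M : ℝ) - N + 1) / 2)) := by
  refine HasExponent.of_bounds ?_ fun ε hε => ?_
  · obtain ⟨a, ha, B, hB, h⟩ := hH.exists_le_measure_isNearlySingular_rpow hN hNM
    have hM : (1 : ℝ) ≤ M := by exact_mod_cast (by omega : 1 ≤ M)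
    obtain ⟨c, hc, h⟩ := h (1 / M) (by positivity) (by rw [div_le_one (by positivity)]; exact hM)
    refine ⟨c, hc, ?_⟩
    filter_upwards [eventually_ge_atTop 1] with ρ hρ
    have hρ0 : 0 < ρ := by linarith
    refine (h ρ hρ).trans (measureReal_mono fun ω hω => ?_)
    refine (lambdaMin_le_of_isNearlySingular _ hω).trans ?_
    have e : (ρ ^ (-(1 / 4) : ℝ)) ^ 2 = ρ ^ (-(1 / 2) : ℝ) := by
      rw [← Real.rpow_natCast, ← Real.rpow_mul hρ0.le]
      norm_num
    rw [mul_pow, e, ← mul_assoc]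
    refine mul_le_of_le_one_left (by positivity) ?_
    rw [div_pow, one_pow, ← mul_div_assoc, mul_one, div_le_one (by positivity)]
    nlinarith
  · obtain ⟨C, hC, h⟩ := hH.exists_measure_lambdaMin_le hN hNM one_pos hε
    refine ⟨C, hC, ?_⟩
    filter_upwards [h, eventually_gt_atTop 0] with ρ hρ hρ0
    refine ENNReal.toReal_le_of_le_ofReal (by positivity) (le_trans (measure_mono fun ω hω => ?_) hρ)
    refine le_trans (Set.mem_ofPred_eq ▸ hω) ?_
    refine le_mul_of_one_le_left (by positivity) ?_
    linarith [frobSq_nonneg (H ω)]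

theorem IsRayleighChannel.hasExponent_outageZF (hN : 2 ≤ N) (hNM : N ≤ M)
    (hH : IsRayleighChannel P H) {R : ℝ} (hR : 0 < R)
    {T : Matrix (Fin N) (Fin M) ℂ → Matrix (Fin M) (Fin N) ℂ} (hT : HasNoiseGainBounds T) :
    HasExponent (outageZF P H (fun G => normalizedPrecoder (T G)) R)
      (-(((M : ℝ) - N + 1) / 2)) := by
  have hN0 : (0 : ℝ) < N := by exact_mod_cast (by omega : 0 < N)
  have hnn : ∀ (ρ : ℝ) (G : Matrix (Fin N) (Fin M) ℂ) k, 0 ≤ ρ →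
      0 ≤ ρ / N / noiseGain G (T G) k := fun ρ G k hρ =>
    div_nonneg (by positivity) (mul_nonneg (frobSq_nonneg _) (sqNorm_nonneg _))
  refine HasExponent.of_bounds ?_ fun ε hε => ?_
  · obtain ⟨a, ha, B, hB, h⟩ := hH.exists_le_measure_isNearlySingular_rpow hN hNM
    obtain ⟨c₀, hc₀, hlow⟩ := hT.lower a ha B hB
    -- The SINR at which a stream carries `R / N` bits; if no stream exceeds it, there is outage.
    set κ : ℝ := 2 ^ (R / N) - 1 with hκ
    have hκ0 : 0 < κ := by
      have := Real.one_lt_rpow (one_lt_two : (1 : ℝ) < 2) (div_pos hR hN0)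
      linarith
    -- With `r = s ρ ^ (-1/4)`, a gain of `c₀ / r⁴` gives SINR `s⁴ / (N c₀)`, which must be at most
    -- `κ`.
    set s : ℝ := min 1 (N * c₀ * κ) with hs
    have hs0 : 0 < s := lt_min one_pos (by positivity)
    have hs1 : s ≤ 1 := min_le_left _ _
    have hs4 : s ^ 4 ≤ N * c₀ * κ :=
      (pow_le_of_le_one hs0.le hs1 (by norm_num)).trans (min_le_right _ _)
    obtain ⟨c, hc, h⟩ := h s hs0 hs1
    refine ⟨c, hc, ?_⟩
    filter_upwards [eventually_ge_atTop 1] with ρ hρ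
    have hρ0 : 0 < ρ := by linarith
    refine (h ρ hρ).trans (measureReal_mono fun ω hω => ?_)
    have hr4 : (s * ρ ^ (-(1 / 4) : ℝ)) ^ 4 = s ^ 4 / ρ := by
      rw [mul_pow, ← Real.rpow_natCast (ρ ^ _), ← Real.rpow_mul hρ0.le]
      norm_num
      rw [Real.rpow_neg_one]
      rfl
    have hk : ∀ k, ρ / N / noiseGain (H ω) (T (H ω)) k ≤ κ := by
      intro k
      rcases hlow _ (by positivity) _ k hω with h0 | h0
      · rw [h0, div_zero]
        exact hκ0.le
      · rw [hr4] at h0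
        have h1 : 0 < c₀ / (s ^ 4 / ρ) := by positivity
        rw [div_le_iff₀ (h1.trans_le h0)]
        calc ρ / N = s ^ 4 / (N * c₀) * (c₀ / (s ^ 4 / ρ)) := by field_simp
          _ ≤ κ * noiseGain (H ω) (T (H ω)) k := by
              gcongr
              rw [div_le_iff₀ (by positivity)]
              linarith
    have hlog : ∀ k, Real.logb 2 (1 + ρ / N / noiseGain (H ω) (T (H ω)) k) ≤ R / N := by
      intro k
      rw [Real.logb_le_iff_le_rpow one_lt_two (by linarith [hnn ρ (H ω) k hρ0.le])]
      linarith [hk k]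
    change ∑ k, _ ≤ R
    simp only [sinr_normalizedPrecoder]
    refine (Finset.sum_le_card_nsmul _ _ _ fun k _ => hlog k).trans_eq ?_
    simp
    field_simp
  · obtain ⟨C₀, hC₀, hup⟩ := hT.upper
    set K : ℝ := √(C₀ * (N * 2 ^ R)) with hK
    have hK0 : 0 < K := by positivity
    obtain ⟨C, hC, h⟩ := hH.exists_measure_lambdaMin_le hN hNM hK0 hε
    refine ⟨C, hC, ?_⟩
    filter_upwards [h, eventually_gt_atTop 0] with ρ hρ hρ0
    refine ENNReal.toReal_le_of_le_ofReal (by positivity) (le_trans (measure_mono fun ω hω => ?_) hρ)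
    have hω' : ∑ k, Real.logb 2 (1 + ρ / N / noiseGain (H ω) (T (H ω)) k) ≤ R := by
      have h1 : ∑ k, _ ≤ R := hω
      simpa only [sinr_normalizedPrecoder] using h1
    have hS := frobSq_nonneg (H ω)
    change lambdaMin (H ω) ≤ K * (1 + frobSq (H ω)) * ρ ^ (-(1 / 2) : ℝ)
    rcases le_or_gt (lambdaMin (H ω)) 0 with hl | hl
    · exact hl.trans (by positivity)
    -- One stream suffices: the rates are nonnegative, so outage bounds each of them by `R`.
    let k : Fin N := ⟨0, by omega⟩
    obtain ⟨hpos, hle⟩ := hup (H ω) k hl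
    have h1 : Real.logb 2 (1 + ρ / N / noiseGain (H ω) (T (H ω)) k) ≤ R :=
      (Finset.single_le_sum
        (f := fun k => Real.logb 2 (1 + ρ / N / noiseGain (H ω) (T (H ω)) k))
        (fun k _ => Real.logb_nonneg one_lt_two (by linarith [hnn ρ (H ω) k hρ0.le]))
        (Finset.mem_univ k)).trans hω'
    rw [Real.logb_le_iff_le_rpow one_lt_two (by linarith [hnn ρ (H ω) k hρ0.le])] at h1
    have h2 : ρ / N / noiseGain (H ω) (T (H ω)) k ≤ 2 ^ R := by linarith
    rw [div_le_iff₀ hpos, div_le_iff₀ hN0] at h2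
    have h3 : ρ ≤ 2 ^ R * (C₀ * (1 + frobSq (H ω)) ^ 2 / lambdaMin (H ω) ^ 2) * N :=
      h2.trans (by gcongr)
    refine le_of_sq_le_sq ?_ (by positivity)
    have e : (ρ ^ (-(1 / 2) : ℝ)) ^ 2 = ρ⁻¹ := by
      rw [← Real.rpow_natCast, ← Real.rpow_mul hρ0.le, ← Real.rpow_neg_one]
      norm_num
    rw [mul_pow, mul_pow, e, hK, Real.sq_sqrt (by positivity), ← div_eq_mul_inv,
      le_div_iff₀ hρ0]
    calc lambdaMin (H ω) ^ 2 * ρ ≤ lambdaMin (H ω) ^ 2 *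
          (2 ^ R * (C₀ * (1 + frobSq (H ω)) ^ 2 / lambdaMin (H ω) ^ 2) * N) := by gcongr
      _ = _ := by field_simp

end PrecodedMIMO

theorem mainTheorem6 {Ω : Type*} [MeasurableSpace Ω] (P : Measure Ω) [IsProbabilityMeasure P]
    (N M : ℕ) (hN : 2 ≤ N) (hNM : N ≤ M)
    (H : Ω → Matrix (Fin N) (Fin M) ℂ) (hH : PrecodedMIMO.IsRayleighChannel P H)
    (c : ℝ) (hc : 0 < c) (R : ℝ) (hR : 0 < R) :
    (PrecodedMIMO.ExpEq (PrecodedMIMO.outageZF P H (PrecodedMIMO.rzfPrecoder c) R)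
        (fun ρ => P.real {ω | PrecodedMIMO.lambdaMin (H ω) ≤ ρ ^ (-(1 / 2) : ℝ)}) ∧
      PrecodedMIMO.HasDiversity (PrecodedMIMO.outageZF P H (PrecodedMIMO.rzfPrecoder c) R)
        (((M : ℝ) - (N : ℝ) + 1) / 2)) ∧
    (PrecodedMIMO.ExpEq (PrecodedMIMO.outageZF P H PrecodedMIMO.mfPrecoder R)
        (fun ρ => P.real {ω | PrecodedMIMO.lambdaMin (H ω) ≤ ρ ^ (-(1 / 2) : ℝ)}) ∧
      PrecodedMIMO.HasDiversity (PrecodedMIMO.outageZF P H PrecodedMIMO.mfPrecoder R)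
        (((M : ℝ) - (N : ℝ) + 1) / 2)) := by
  have hl := hH.hasExponent_lambdaMin hN hNM
  have hrzf := hH.hasExponent_outageZF hN hNM hR
    (PrecodedMIMO.hasNoiseGainBounds_regularizedZeroForcing hc)
  have hmf := hH.hasExponent_outageZF hN hNM hR PrecodedMIMO.hasNoiseGainBounds_matchedFilter
  exact ⟨⟨⟨_, hrzf, hl⟩, hrzf⟩, ⟨_, hmf, hl⟩, hmf⟩
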